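/- Let $D=\mathbb{C}[x_1,\dots,x_n]\langle\partial_1,\dots,\partial_n\rangle$ be the Weyl algebra with the filtration $F_k(D)$ by the order of operators, so that $\mathrm{gr}^F(D)=\mathbb{C}[x,\xi]$, and let $\mathbb{K}=\mathbb{C}(x_1,\dots,x_n)$. For $\mathbf{n}\in\mathbb{Z}^r$ let $D^r[\mathbf{n}]$ be $D^r$ with the filtration $F_k(D^r[\mathbf{n}])=\bigoplus_i F_{k-n_i}(D)$. Let $M$ be a $D$-module with a good $F$-filtration $(F_k(M))_{k\in\mathbb{Z}}$, i.e. $M$ is isomorphic, as a filtered module, to some $D^r[\mathbf{n}]/N$ with the quotient filtration. Let $$0\to D^{r_\delta}[\mathbf{n}^{(\delta)}]\to\cdots\to D^{r_0}[\mathbf{n}^{(0)}]\to M\to 0$$ be a filtered free resolution (exact on each piece $F_k$), put $K_F(M;T)=\sum_i(-1)^i\sum_j T^{\mathbf{n}^{(i)}_j}\in\mathbb{Z}[T,T^{-1}]$, and let $\mathcal{C}_F(M;T)$ be the nonzero term of least degree in the power series $K_F(M;1-T)\in\mathbb{Z}[[T]]$ (and $0$ if this series is $0$). Write $\mathcal{C}_F(M;T)=mT^d$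 with $m\in\mathbb{Z}$, $d\in\mathbb{N}$. For $x_0\in\mathbb{C}^n$ let $\mathrm{gr}^F(M)^{x_0}=\mathrm{gr}^F(M)/\sum_i(x_i-(x_0)_i)\,\mathrm{gr}^F(M)$, a graded $\mathbb{C}[\xi]$-module. The multiplicity of a finitely generated graded $\mathbb{C}[\xi]$-module $N=\bigoplus_j N_j\neq 0$ of dimension $s$ is $\lim_{k\to\infty} s!\,k^{-s}\dim_{\mathbb{C}}\bigoplus_{j\le k}N_j$, and that of $N=0$ is $0$. Let $\mathrm{char}\,M\subseteq T^*\mathbb{C}^n=\mathbb{C}^n\times\mathbb{C}^n$ be the zero set of the annihilator of $\mathrm{gr}^F(M)$, and $\pi:T^*\mathbb{C}^n\to\mathbb{C}^n$ the projection. "For generic $x_0$" means: for all $x_0$ outside the zero set of some nonzero polynomial. 1. For generic $x_0$, $m$ is the multiplicity of $\mathrm{gr}^F(M)^{x_0}$. If $m\neq0$, then for generic $x_0$ the integer $d$ is the codimension of the $\mathbb{C}[\xi]$-module $\mathrm{gr}^F(M)^{x_0}$ (that is, $n$ minus the dimension of its support), and also the codimension of $\mathrm{char}\,M\cap\pi^{-1}(x_0)$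 in $\pi^{-1}(x_0)\cong\mathbb{C}^n$. If $m=0$, then $\mathrm{gr}^F(M)^{x_0}=0$ and $\mathrm{char}\,M\cap\pi^{-1}(x_0)=\emptyset$ for generic $x_0$. 2. If moreover $M$ is holonomic (i.e. $M=0$ or $\dim\mathrm{char}\,M=n$), then $\mathbb{K}\otimes_{\mathbb{C}[x]}M$ and $\mathbb{K}\otimes_{\mathbb{C}[x]}\mathrm{gr}^F(M)$ are finite dimensional over $\mathbb{K}$ and $m=\mathrm{rank}\,M=\dim_{\mathbb{K}}\mathbb{K}\otimes_{\mathbb{C}[x]}\mathrm{gr}^F(M)$, where $\mathrm{rank}\,M=\dim_{\mathbb{K}}\mathbb{K}\otimes_{\mathbb{C}[x]}M$ is the holonomic rank. -/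

import Mathlib

open scoped TensorProduct LaurentPolynomial

noncomputable section

set_option linter.unusedSectionVars false

namespace WeylMultidegree

/-! ### The Weyl algebra and its order filtration -/

/-- The polynomial ring `ℂ[x_1, …, x_n]`. -/
abbrev PolyX (n : ℕ) : Type := MvPolynomial (Fin n) ℂ

/-- The Weyl algebra `D = ℂ[x]⟨∂_1, …, ∂_n⟩`, as the algebra of linear operators on `ℂ[x]` generated
by the multiplications by polynomials and by the partial derivatives. -/
def weylSubalgebra (n : ℕ) : Subalgebra ℂ (Module.End ℂ (PolyX n)) :=
  Algebra.adjoin ℂ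
    (Set.range (fun p : PolyX n => LinearMap.mulLeft ℂ p) ∪
      Set.range (fun i : Fin n => (MvPolynomial.pderiv i : Derivation ℂ (PolyX n) (PolyX n)).toLinearMap))

/-- The Weyl algebra as a type. -/
def Weyl (n : ℕ) : Type := weylSubalgebra n

instance (n : ℕ) : Ring (Weyl n) := inferInstanceAs (Ring (weylSubalgebra n))

instance (n : ℕ) : Algebra ℂ (Weyl n) := inferInstanceAs (Algebra ℂ (weylSubalgebra n))

/-- The inclusion `ℂ[x] → D`. -/
def polyToWeyl (n : ℕ) : PolyX n →ₐ[ℂ] Weyl n :=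
  (Algebra.lmul ℂ (PolyX n)).codRestrict (weylSubalgebra n)
    (fun p => Algebra.subset_adjoin (Or.inl ⟨p, rfl⟩))

/-- The derivation `∂_i ∈ D`. -/
def del {n : ℕ} (i : Fin n) : Weyl n :=
  ⟨(MvPolynomial.pderiv i : Derivation ℂ (PolyX n) (PolyX n)).toLinearMap,
    Algebra.subset_adjoin (Or.inr ⟨i, rfl⟩)⟩

/-- `D` is a `ℂ[x]`-module by multiplication from the left. -/
instance weylModule (n : ℕ) : Module (PolyX n) (Weyl n) :=
  Module.compHom (Weyl n) (polyToWeyl n).toRingHom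

theorem polyX_smul_def {n : ℕ} (p : PolyX n) (P : Weyl n) : p • P = polyToWeyl n p * P := rfl

/-- The monomial `∂^β = ∂_1^{β_1} ⋯ ∂_n^{β_n}`. -/
def delPow {n : ℕ} (β : Fin n → ℕ) : Weyl n :=
  (List.ofFn fun i => del i ^ β i).prod

/-- `F_k(D)`: the operators `∑ a_β(x) ∂^β` of order `|β| ≤ k`. -/
def orderF (n : ℕ) (k : ℤ) : Submodule (PolyX n) (Weyl n) :=
  Submodule.span (PolyX n) {P | ∃ β : Fin n → ℕ, ((∑ i, β i : ℕ) : ℤ) ≤ k ∧ P = delPow β}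

theorem del_mem_orderF {n : ℕ} (i : Fin n) : del i ∈ orderF n 1 := by
  classical
  refine Submodule.subset_span ⟨Pi.single i 1, by simp, ?_⟩
  unfold delPow
  have key : ∀ (m : ℕ) (f : Fin m → Weyl n) (j : Fin m), (∀ k, k ≠ j → f k = 1) →
      (List.ofFn f).prod = f j := by
    intro m
    induction m with
    | zero => intro f j; exact j.elim0
    | succ m ih =>
      intro f j h
      rw [List.ofFn_succ, List.prod_cons]
      induction j using Fin.cases with
      | zero =>
        have h1 : (fun k : Fin m => f k.succ) = fun _ => 1 := by
          funext k; exact h _ (Fin.succ_ne_zero k)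
        rw [h1]; simp
      | succ j =>
        rw [h 0 (Fin.succ_ne_zero j).symm, one_mul]
        exact ih (fun k => f k.succ) j (fun k hk => h _ (fun e => hk (Fin.succ_injective _ e)))
  rw [key n _ i (fun k hk => by simp [hk])]
  simp

theorem del_mul_polyToWeyl {n : ℕ} (i : Fin n) (p : PolyX n) :
    del i * polyToWeyl n p = polyToWeyl n p * del i + polyToWeyl n (MvPolynomial.pderiv i p) := by
  apply Subtype.ext (p := fun E => E ∈ weylSubalgebra n)
  apply LinearMap.ext
  intro q
  change MvPolynomial.pderiv i (p * q) = p * MvPolynomial.pderiv i q + MvPolynomial.pderiv i p * q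
  rw [Derivation.leibniz, smul_eq_mul, smul_eq_mul, mul_comm q]

theorem del_comm {n : ℕ} (i j : Fin n) : del i * del j = del j * del i := by
  apply Subtype.ext (p := fun E => E ∈ weylSubalgebra n)
  have h : ⁅(MvPolynomial.pderiv i : Derivation ℂ (PolyX n) (PolyX n)),
      (MvPolynomial.pderiv j : Derivation ℂ (PolyX n) (PolyX n))⁆ = 0 := by
    apply MvPolynomial.derivation_ext
    intro k
    classical
    rw [Derivation.commutator_apply, MvPolynomial.pderiv_X, MvPolynomial.pderiv_X]
    rcases eq_or_ne k i with rfl | h1 <;> rcases eq_or_ne k j with rfl | h2 <;>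
      simp_all
  apply LinearMap.ext
  intro q
  have := congrArg (fun E : Derivation ℂ (PolyX n) (PolyX n) => E q) h
  simp only [Derivation.commutator_apply, Derivation.coe_zero, Pi.zero_apply, sub_eq_zero] at this
  exact this

/-! ### Filtered `D`-modules

A left `D`-module `M` carries its `ℂ[x]`-module structure by restriction of scalars, which is what
`IsScalarTower (PolyX n) (Weyl n) M` says. -/

section Filtered

variable (n : ℕ) (M : Type*) [AddCommGroup M] [Module (Weyl n) M] [Module (PolyX n) M]
  [IsScalarTower (PolyX n) (Weyl n) M]

/-- An `F`-filtration of `M`: increasing, exhaustive and compatible with the order filtration of `D`.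
The pieces are `ℂ[x]`-submodules because `F_0(D) = ℂ[x]`. -/
structure FFiltration where
  /-- the piece `F_d(M)` -/
  toFun : ℤ → Submodule (PolyX n) M
  mono : Monotone toFun
  exhaustive : ∀ v : M, ∃ d, v ∈ toFun d
  smul_mem : ∀ (k d : ℤ) (P : Weyl n) (v : M), P ∈ orderF n k → v ∈ toFun d → P • v ∈ toFun (k + d)

end Filtered

/-- `F_k(D^r[𝐧]) = ⨁_i F_{k - n_i}(D)`, where `𝐧` is the vector of shifts. -/
def freeF (n : ℕ) {r : ℕ} (shift : Fin r → ℤ) (k : ℤ) : Submodule (PolyX n) (Fin r → Weyl n) :=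
  Submodule.pi Set.univ fun i => orderF n (k - shift i)

namespace FFiltration

variable {n : ℕ} {M : Type*} [AddCommGroup M] [Module (Weyl n) M] [Module (PolyX n) M]
  [IsScalarTower (PolyX n) (Weyl n) M] (F : FFiltration n M)

/-- The filtration is good: `M` is isomorphic, as a filtered `D`-module, to some `D^r[𝐧]/N` with the
quotient filtration. -/
def IsGood : Prop :=
  ∃ (r : ℕ) (shift : Fin r → ℤ) (N : Submodule (Weyl n) (Fin r → Weyl n))
    (e : ((Fin r → Weyl n) ⧸ N) ≃ₗ[Weyl n] M),
    ∀ k : ℤ, (F.toFun k : Set M) =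
      (fun v => e (N.mkQ v)) '' (freeF n shift k : Set (Fin r → Weyl n))

/-- A filtered free resolution
`0 → D^{r_δ}[𝐧^{(δ)}] → ⋯ → D^{r_1}[𝐧^{(1)}] → D^{r_0}[𝐧^{(0)}] → M → 0`:
the maps are `D`-linear and filtered, and for every `k` the complex of the pieces `F_k` is exact. -/
structure FreeResolution where
  /-- the length `δ` -/
  length : ℕ
  /-- the ranks `r_i` -/
  rank : ℕ → ℕ
  rank_eq_zero : ∀ i, length < i → rank i = 0
  /-- the shifts `𝐧^{(i)}` -/
  shift : ∀ i, Fin (rank i) → ℤ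
  /-- the augmentation `D^{r_0} → M` -/
  aug : (Fin (rank 0) → Weyl n) →ₗ[Weyl n] M
  /-- the differentials `D^{r_{i+1}} → D^{r_i}` -/
  diff : ∀ i, (Fin (rank (i + 1)) → Weyl n) →ₗ[Weyl n] (Fin (rank i) → Weyl n)
  aug_image : ∀ k : ℤ,
    aug '' (freeF n (shift 0) k : Set (Fin (rank 0) → Weyl n)) = F.toFun k
  exact_zero : ∀ k : ℤ,
    diff 0 '' (freeF n (shift 1) k : Set (Fin (rank 1) → Weyl n)) =
      {v | v ∈ freeF n (shift 0) k ∧ aug v = 0}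
  exact_succ : ∀ (i : ℕ) (k : ℤ),
    diff (i + 1) '' (freeF n (shift (i + 2)) k : Set (Fin (rank (i + 2)) → Weyl n)) =
      {v | v ∈ freeF n (shift (i + 1)) k ∧ diff i v = 0}

end FFiltration

/-! ### The `K`-polynomial and the multidegree -/

/-- The unit `1 - T` of `ℤ⟦T⟧`. -/
def oneSubT : (PowerSeries ℤ)ˣ where
  val := 1 - PowerSeries.X
  inv := PowerSeries.mk 1
  val_inv := by rw [mul_comm]; exact PowerSeries.mk_one_mul_one_sub_eq_one ℤ
  inv_val := PowerSeries.mk_one_mul_one_sub_eq_one ℤ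

/-- The substitution `K(T) ↦ K(1 - T)` from `ℤ[T, T⁻¹]` to `ℤ⟦T⟧`. -/
def substOneSub : ℤ[T;T⁻¹] →+* PowerSeries ℤ :=
  LaurentPolynomial.eval₂ (Int.castRingHom (PowerSeries ℤ)) oneSubT

/-- The nonzero term of least degree of a power series (`0` for the zero series). -/
def leastTerm (f : PowerSeries ℤ) : Polynomial ℤ :=
  Polynomial.monomial f.order.toNat (PowerSeries.coeff f.order.toNat f)

namespace FFiltration.FreeResolution

variable {n : ℕ} {M : Type*} [AddCommGroup M] [Module (Weyl n) M] [Module (PolyX n) M]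
  [IsScalarTower (PolyX n) (Weyl n) M] {F : FFiltration n M}

/-- `K_F(M;T) = ∑_i (-1)^i ∑_j T^{n^{(i)}_j}`. -/
def kPolynomial (L : F.FreeResolution) : ℤ[T;T⁻¹] :=
  ∑ i ∈ Finset.range (L.length + 1),
    (-1) ^ i * ∑ j : Fin (L.rank i), LaurentPolynomial.T (L.shift i j)

/-- The multidegree `C_F(M;T)`: the term of least degree of `K_F(M;1-T)`. -/
def multidegree (L : F.FreeResolution) : Polynomial ℤ :=
  leastTerm (substOneSub L.kPolynomial)

end FFiltration.FreeResolution

/-! ### The associated graded module -/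

/-- `gr^F(D) = ℂ[x][ξ]`. -/
abbrev GrD (n : ℕ) : Type := MvPolynomial (Fin n) (PolyX n)

/-- The polynomial ring `ℂ[ξ_1, …, ξ_n]`. -/
abbrev PolyXi (n : ℕ) : Type := MvPolynomial (Fin n) ℂ

namespace FFiltration

variable {n : ℕ} {M : Type*} [AddCommGroup M] [Module (Weyl n) M] [Module (PolyX n) M]
  [IsScalarTower (PolyX n) (Weyl n) M] (F : FFiltration n M)

/-- `gr^F_d(M) = F_d(M) / F_{d-1}(M)`. -/
def GrPiece (d : ℤ) : Type _ := F.toFun d ⧸ (F.toFun (d - 1)).submoduleOf (F.toFun d)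

instance (d : ℤ) : AddCommGroup (F.GrPiece d) :=
  inferInstanceAs (AddCommGroup (F.toFun d ⧸ (F.toFun (d - 1)).submoduleOf (F.toFun d)))

instance (d : ℤ) : Module (PolyX n) (F.GrPiece d) :=
  inferInstanceAs (Module (PolyX n) (F.toFun d ⧸ (F.toFun (d - 1)).submoduleOf (F.toFun d)))

/-- The class in `gr^F_d(M)` of an element of `F_d(M)`. -/
def toGrPiece (d : ℤ) : F.toFun d →ₗ[PolyX n] F.GrPiece d :=
  ((F.toFun (d - 1)).submoduleOf (F.toFun d)).mkQ

theorem toGrPiece_surjective (d : ℤ) : Function.Surjective (F.toGrPiece d) :=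
  Submodule.mkQ_surjective _

theorem toGrPiece_eq_zero {d : ℤ} (v : F.toFun d) :
    F.toGrPiece d v = 0 ↔ (v : M) ∈ F.toFun (d - 1) := by
  unfold toGrPiece
  exact Submodule.Quotient.mk_eq_zero _

/-- `gr^F(M) = ⨁_d F_d(M) / F_{d-1}(M)`. -/
def Gr : Type _ := DirectSum ℤ F.GrPiece

instance : AddCommGroup F.Gr := inferInstanceAs (AddCommGroup (DirectSum ℤ F.GrPiece))

instance : Module (PolyX n) F.Gr := inferInstanceAs (Module (PolyX n) (DirectSum ℤ F.GrPiece))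

/-- The inclusion `gr^F_d(M) → gr^F(M)`. -/
def incl (d : ℤ) : F.GrPiece d →ₗ[PolyX n] F.Gr :=
  DirectSum.lof (PolyX n) ℤ F.GrPiece d

theorem del_smul_mem (i : Fin n) {d : ℤ} {v : M} (hv : v ∈ F.toFun d) :
    del i • v ∈ F.toFun (d + 1) := by
  rw [add_comm]
  exact F.smul_mem 1 d (del i) v (del_mem_orderF i) hv

theorem poly_smul (p : PolyX n) (v : M) : polyToWeyl n p • v = p • v := by
  rw [← one_smul (Weyl n) v, ← smul_assoc p (1 : Weyl n) v, polyX_smul_def, mul_one, one_smul]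

theorem del_smul_poly_smul (i : Fin n) (p : PolyX n) (v : M) :
    del i • p • v = p • del i • v + MvPolynomial.pderiv i p • v := by
  rw [← poly_smul p v, ← poly_smul p (del i • v), ← poly_smul (MvPolynomial.pderiv i p) v,
    smul_smul, smul_smul, del_mul_polyToWeyl, add_smul]

/-- The map `gr_d → gr_{d+1}` that sends the class of `v` to the class of `∂_i v`. -/
def xiPiece (i : Fin n) (d : ℤ) : F.GrPiece d →ₗ[PolyX n] F.GrPiece (d + 1) :=
  Submodule.liftQ ((F.toFun (d - 1)).submoduleOf (F.toFun d))
    { toFun := fun v => F.toGrPiece (d + 1) ⟨del i • (v : M), F.del_smul_mem i v.2⟩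
      map_add' := fun v w => by
        rw [← map_add]
        exact congrArg _ (Subtype.ext (smul_add _ _ _))
      map_smul' := fun p v => by
        rw [RingHom.id_apply, ← map_smul, ← sub_eq_zero, ← map_sub, toGrPiece_eq_zero]
        change del i • p • (v : M) - p • del i • (v : M) ∈ F.toFun (d + 1 - 1)
        rw [del_smul_poly_smul, add_sub_cancel_left]
        exact Submodule.smul_mem _ _ (F.mono (by omega) v.2) }
    (fun v hv => by
      refine LinearMap.mem_ker.2 ((F.toGrPiece_eq_zero _).2 ?_)
      have h := F.del_smul_mem i (d := d - 1) (v := (v : M)) hv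
      exact F.mono (by omega) h)

theorem xiPiece_toGrPiece (i : Fin n) (d : ℤ) (v : F.toFun d) :
    F.xiPiece i d (F.toGrPiece d v) =
      F.toGrPiece (d + 1) ⟨del i • (v : M), F.del_smul_mem i v.2⟩ := rfl

/-- The action of `ξ_i` on `gr^F(M)`. -/
def xi (i : Fin n) : F.Gr →ₗ[PolyX n] F.Gr :=
  DirectSum.toModule (PolyX n) ℤ F.Gr fun d => F.incl (d + 1) ∘ₗ F.xiPiece i d

theorem xi_incl (i : Fin n) (d : ℤ) (g : F.GrPiece d) :
    F.xi i (F.incl d g) = F.incl (d + 1) (F.xiPiece i d g) := by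
  unfold xi incl
  exact DirectSum.toModule_lof _ _ _

theorem gr_hom_ext {N : Type*} [AddCommGroup N] [Module (PolyX n) N] {f g : F.Gr →ₗ[PolyX n] N}
    (h : ∀ d x, f (F.incl d x) = g (F.incl d x)) : f = g := by
  exact DirectSum.linearMap_ext (PolyX n) fun d => LinearMap.ext fun x => h d x

theorem xiPiece_comm (i j : Fin n) (d : ℤ) (x : F.GrPiece d) :
    F.xiPiece i (d + 1) (F.xiPiece j d x) = F.xiPiece j (d + 1) (F.xiPiece i d x) := by
  obtain ⟨v, rfl⟩ := F.toGrPiece_surjective d x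
  rw [xiPiece_toGrPiece, xiPiece_toGrPiece, xiPiece_toGrPiece, xiPiece_toGrPiece]
  have h : del i • del j • (v : M) = del j • del i • (v : M) := by
    rw [smul_smul, smul_smul, del_comm]
  exact congrArg (F.toGrPiece (d + 1 + 1)) (Subtype.ext h)

theorem xi_comm (i j : Fin n) : F.xi i * F.xi j = F.xi j * F.xi i := by
  refine F.gr_hom_ext fun d x => ?_
  rw [Module.End.mul_apply, Module.End.mul_apply, xi_incl, xi_incl, xi_incl, xi_incl,
    xiPiece_comm]

/-- The ring homomorphism `ℂ[x][ξ] → End(gr^F(M))` that gives the action of `gr^F(D)`. -/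
def grAction : GrD n →ₐ[PolyX n] Module.End (PolyX n) F.Gr :=
  letI : CommRing (Algebra.adjoin (PolyX n) (Set.range F.xi)) :=
    { (inferInstance : Ring (Algebra.adjoin (PolyX n) (Set.range F.xi))) with
      mul_comm := (Algebra.isMulCommutative_adjoin (PolyX n) (by
        rintro _ ⟨i, rfl⟩ _ ⟨j, rfl⟩
        exact F.xi_comm i j)).is_comm.comm }
  (Algebra.adjoin (PolyX n) (Set.range F.xi)).val.comp
    (MvPolynomial.aeval fun i => ⟨F.xi i, Algebra.subset_adjoin ⟨i, rfl⟩⟩)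

theorem grAction_X (i : Fin n) : F.grAction (MvPolynomial.X i) = F.xi i := by
  simp [grAction]

/-- `gr^F(M)` as a module over `gr^F(D) = ℂ[x][ξ]`. -/
instance : Module (GrD n) F.Gr := Module.compHom F.Gr F.grAction.toRingHom

theorem X_smul (i : Fin n) (g : F.Gr) : (MvPolynomial.X i : GrD n) • g = F.xi i g := by
  rw [← grAction_X]; rfl

theorem C_smul (p : PolyX n) (g : F.Gr) : (MvPolynomial.C p : GrD n) • g = p • g := by
  change F.grAction (algebraMap (PolyX n) (GrD n) p) g = p • g
  rw [AlgHom.commutes]; rfl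

/-! ### Specialization at a point -/

/-- The ideal of `ℂ[x][ξ]` generated by the `x_i - (x₀)_i`. -/
def pointIdeal (x₀ : Fin n → ℂ) : Ideal (GrD n) :=
  Ideal.span (Set.range fun i =>
    (MvPolynomial.C (MvPolynomial.X i - MvPolynomial.C (x₀ i)) : GrD n))

/-- `gr^F(M)^{x₀} = gr^F(M) / (x - x₀) gr^F(M)`. -/
def Fiber (x₀ : Fin n → ℂ) : Type _ :=
  F.Gr ⧸ (pointIdeal x₀ • (⊤ : Submodule (GrD n) F.Gr))

variable (x₀ : Fin n → ℂ)

instance : AddCommGroup (F.Fiber x₀) :=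
  inferInstanceAs (AddCommGroup (F.Gr ⧸ (pointIdeal x₀ • (⊤ : Submodule (GrD n) F.Gr))))

instance : Module (GrD n) (F.Fiber x₀) :=
  inferInstanceAs (Module (GrD n) (F.Gr ⧸ (pointIdeal x₀ • (⊤ : Submodule (GrD n) F.Gr))))

/-- `gr^F(M)^{x₀}` as a `ℂ[ξ]`-module, through the inclusion `ℂ[ξ] ⊆ ℂ[x][ξ]`. (The variables of
`MvPolynomial (Fin n) ℂ` act here as the `ξ_i`; the `x_i` act by the scalars `(x₀)_i`.) -/
instance fiberModule : Module (PolyXi n) (F.Fiber x₀) :=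
  Module.compHom (F.Fiber x₀)
    (MvPolynomial.map (σ := Fin n) (MvPolynomial.C : ℂ →+* PolyX n))

/-- `gr^F(M)^{x₀}` as a complex vector space. -/
instance fiberVectorSpace : Module ℂ (F.Fiber x₀) :=
  Module.compHom (F.Fiber x₀) (MvPolynomial.C : ℂ →+* PolyXi n)

/-- The homogeneous part of degree `d` of `gr^F(M)^{x₀}`: the image of `gr^F_d(M)`. -/
def fiberPiece (d : ℤ) : Submodule ℂ (F.Fiber x₀) :=
  Submodule.span ℂ (Set.range fun g : F.GrPiece d =>
    (Submodule.Quotient.mk (F.incl d g) : F.Fiber x₀))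

end FFiltration

/-! ### Multiplicity and codimension -/

/-- `e` is the multiplicity of the `ℂ[ξ]`-module `N` with the grading `N_j`, `j ∈ ℤ`: it is `0` if
`N = 0`, and otherwise `dim_ℂ (⨁_{j ≤ k} N_j) ~ e k^s / s!` for `k → ∞`, with `s = dim N`. -/
def IsMultiplicity {n : ℕ} {N : Type*} [AddCommGroup N] [Module (PolyXi n) N] [Module ℂ N]
    (piece : ℤ → Submodule ℂ N) (e : ℤ) : Prop :=
  (Subsingleton N ∧ e = 0) ∨
    ∃ s : ℕ, Module.supportDim (PolyXi n) N = s ∧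
      (∀ k : ℤ, Module.Finite ℂ (⨆ j ≤ k, piece j : Submodule ℂ N)) ∧
      Filter.Tendsto
        (fun k : ℕ => (s.factorial : ℝ) *
          (Module.finrank ℂ (⨆ j ≤ (k : ℤ), piece j : Submodule ℂ N) : ℝ) / (k : ℝ) ^ s)
        Filter.atTop (nhds (e : ℝ))

/-- The `ℂ[ξ]`-module `N ≠ 0` has codimension `d`, that is, its support has dimension `n - d`. -/
def HasCodim (n : ℕ) (N : Type*) [AddCommGroup N] [Module (PolyXi n) N] (d : ℕ) : Prop :=
  Module.supportDim (PolyXi n) N + d = n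

/-- The algebraic set `V ⊆ ℂ^n`, `V ≠ ∅`, has codimension `d`, that is, its coordinate ring has Krull
dimension `n - d`. -/
def SetHasCodim {n : ℕ} (V : Set (Fin n → ℂ)) (d : ℕ) : Prop :=
  ringKrullDim (PolyXi n ⧸ MvPolynomial.vanishingIdeal ℂ V) + d = n

namespace FFiltration

variable {n : ℕ} {M : Type*} [AddCommGroup M] [Module (Weyl n) M] [Module (PolyX n) M]
  [IsScalarTower (PolyX n) (Weyl n) M] (F : FFiltration n M)

/-- The characteristic variety in `T^*ℂ^n = ℂ^n × ℂ^n`: the zero set of the annihilator of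
`gr^F(M)` in `ℂ[x][ξ]`. -/
def charVariety : Set ((Fin n → ℂ) × (Fin n → ℂ)) :=
  {p | ∀ f ∈ Module.annihilator (GrD n) F.Gr,
    MvPolynomial.eval₂ (MvPolynomial.eval p.1) p.2 f = 0}

/-- `char M ∩ π⁻¹(x₀)`, as a subset of `π⁻¹(x₀) = ℂ^n`. -/
def charFiber (x₀ : Fin n → ℂ) : Set (Fin n → ℂ) :=
  Prod.snd '' (F.charVariety ∩ Prod.fst ⁻¹' {x₀})

/-- `M` is holonomic: `M = 0` or the characteristic variety has dimension `n`. -/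
def IsHolonomic : Prop :=
  Subsingleton M ∨ Module.supportDim (GrD n) F.Gr = n

end FFiltration

/-- The field of rational functions `𝕂 = ℂ(x_1, …, x_n)`. -/
abbrev RatX (n : ℕ) : Type := FractionRing (PolyX n)

end WeylMultidegree

end

open scoped TensorProduct LaurentPolynomial

noncomputable section

set_option linter.unusedSectionVars false

namespace WeylMultidegree

/-! ### Growth of filtrations and the dimension of the support -/

/-! Everything is read off from one function, h(k) = rank of F_k(M) over ℂ[x].

The module F_k(D) is free over ℂ[x] on the ∂^β with |β| ≤ k, so its rank is the binomial coefficient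
C(n+k, n), with generating function (1-T)^{-(n+1)}. Additivity of the rank along the resolution
gives ∑ h(k) T^k = K(T)/(1-T)^{n+1} (`finrank_piece`). A least term m T^d of K(1-T) means K =
(1-T)^d Q with Q(1) = m, so h(k) ~ m k^{n-d}/(n-d)!. Since h is monotone and nonnegative, d > n is
impossible when m ≠ 0, and m = 0 forces h = 0 (`growth_of_leastTerm`).

The generic fiber has h as its cumulative Hilbert function. For one k this is clear outside a
hypersurface, but a single hypersurface must serve all k. A Gröbner-type argument provides it: the
monomials ξ^β g_j that are not, up to torsion, combinations of smaller ones are independent, and by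
Dickson's lemma the powers of one polynomial q clear all denominators (`exists_standard`). If q(x₀)
≠ 0, the standard monomials specialize to a basis of the fiber in every degree range
(`exists_finrank_fiberUpTo`). The multiplicity is then the limit above, and Noether normalization
shows that the degree of growth is the dimension of the support (`supportDim_fiber`). The statement
on the characteristic variety follows from Supp(N/IN) = Supp N ∩ V(I) and the Nullstellensatz.

In the holonomic case, the products of x-monomials with standard monomials are independent over ℂ,
so gr(M) grows at least like k^{n+(n-d)} and has dimension at least n+(n-d)
(`add_le_of_supportDim_gr`). Dimension n forces d = n, so h is eventually the constant m, which is
the rank of M and of gr(M). -/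

theorem ringKrullDim_eq_of_isIntegral_of_injective {A B : Type*} [CommRing A] [CommRing B]
    [Algebra A B] [Algebra.IsIntegral A B] (h : Function.Injective (algebraMap A B)) :
    ringKrullDim B = ringKrullDim A := by
  apply le_antisymm
  -- Incomparability: contraction of primes is strictly monotone along an integral extension.
  · refine Order.krullDim_le_of_strictMono (PrimeSpectrum.comap (algebraMap A B)) fun P Q hPQ => ?_
    exact Ideal.IsIntegral.comap_lt_comap (R := A) (I := P.asIdeal) (J := Q.asIdeal) hPQ
  -- Going up lifts chains of the same length; lying over the zero ideal starts the chain, and this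
  -- is where injectivity enters.
  · have lift : ∀ p : LTSeries (PrimeSpectrum A), ∃ q : LTSeries (PrimeSpectrum B),
        q.length = p.length ∧ PrimeSpectrum.comap (algebraMap A B) q.last = p.last := by
      intro p
      induction p using RelSeries.inductionOn' with
      | singleton P =>
        obtain ⟨Q, -, hQ, hQP⟩ := Ideal.exists_ideal_over_prime_of_isIntegral P.asIdeal
          (⊥ : Ideal B) (by rw [← RingHom.ker_eq_comap_bot, (RingHom.injective_iff_ker_eq_bot _).1 h]
                            exact bot_le)
        exact ⟨RelSeries.singleton _ ⟨Q, hQ⟩, rfl, PrimeSpectrum.ext hQP⟩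
      | snoc p P hP ih =>
        obtain ⟨q, hq, hql⟩ := ih
        have hlt : p.last < P := hP
        obtain ⟨Q, hle, hQ, hQP⟩ := Ideal.exists_ideal_over_prime_of_isIntegral P.asIdeal
          q.last.asIdeal (by
            rw [← hql] at hlt
            exact hlt.le)
        refine ⟨q.snoc ⟨Q, hQ⟩ (lt_of_le_of_ne hle ?_), by simp [hq], ?_⟩
        · intro e
          have e' : q.last = ⟨Q, hQ⟩ := PrimeSpectrum.ext e
          rw [e'] at hql
          exact hlt.ne (hql.symm.trans (PrimeSpectrum.ext hQP))
        · simpa using PrimeSpectrum.ext hQP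
    refine iSup_le fun p => ?_
    obtain ⟨q, hq, -⟩ := lift p
    rw [← hq]
    exact le_iSup (fun q : LTSeries (PrimeSpectrum B) => (q.length : WithBot ℕ∞)) q

section Growth

variable {k A N : Type*} [Field k] [CommRing A] [Algebra k A] [AddCommGroup N]
  [Module k N] [Module A N] [IsScalarTower k A N]

/-- Noether normalization for a module `N`: there are `supportDim N` elements of `A` such that `N` is
finite over the polynomials in them, and some `v ∈ N` is annihilated by no such polynomial. -/
theorem exists_noether_normalization [Algebra.FiniteType k A] [Module.Finite A N] [Nontrivial N] :
    ∃ s : ℕ, Module.supportDim A N = s ∧ ∃ y : Fin s → A,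
      (∃ (t : ℕ) (g : Fin t → N),
        Submodule.span k {z | ∃ (β : Fin s → ℕ) (l : Fin t), z = (∏ i, y i ^ β i) • g l} = ⊤) ∧
      ∃ v : N, LinearIndependent k (fun β : Fin s → ℕ => (∏ i, y i ^ β i) • v) := by
  classical
  -- Normalizing A/Ann(N) instead of A makes the number of variables equal to the dimension of the
  -- support.
  let I := Module.annihilator A N
  have hI : I ≠ ⊤ := by
    intro h
    have := Module.annihilator_eq_top_iff.1 h
    exact not_subsingleton N this
  have : Nontrivial (A ⧸ I) := Ideal.Quotient.nontrivial_iff.2 hI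
  let _ : Module (A ⧸ I) N := Module.quotientAnnihilator
  have tower : IsScalarTower A (A ⧸ I) N := ⟨fun a b v => by
    obtain ⟨b, rfl⟩ := Ideal.Quotient.mk_surjective b
    change (a * b) • v = a • b • v
    rw [mul_smul]⟩
  obtain ⟨s, g, hinj, hfin⟩ := exists_finite_inj_algHom_of_fg k (A ⧸ I)
  let _ : Algebra (MvPolynomial (Fin s) k) (A ⧸ I) := g.toRingHom.toAlgebra
  have hfin' : Module.Finite (MvPolynomial (Fin s) k) (A ⧸ I) := hfin
  let _ : Module (MvPolynomial (Fin s) k) N := Module.compHom N g.toRingHom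
  have tower' : IsScalarTower (MvPolynomial (Fin s) k) (A ⧸ I) N := ⟨fun a b v => by
    change (g a * b) • v = g a • b • v
    rw [mul_smul]⟩
  have : Module.Finite (A ⧸ I) N := Module.Finite.of_restrictScalars_finite A _ _
  have hN : Module.Finite (MvPolynomial (Fin s) k) N := Module.Finite.trans (A ⧸ I) N
  have hint : Algebra.IsIntegral (MvPolynomial (Fin s) k) (A ⧸ I) := inferInstance
  refine ⟨s, ?_, fun i => (Ideal.Quotient.mk_surjective (g (MvPolynomial.X i))).choose, ?_⟩
  · rw [Module.supportDim_eq_ringKrullDim_quotient_annihilator,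
      ringKrullDim_eq_of_isIntegral_of_injective (A := MvPolynomial (Fin s) k) hinj,
      MvPolynomial.ringKrullDim_of_isNoetherianRing, ringKrullDim_eq_zero_of_field]
    simp
  set y : Fin s → A := fun i => (Ideal.Quotient.mk_surjective (g (MvPolynomial.X i))).choose with hy
  have hyg : ∀ i, Ideal.Quotient.mk I (y i) = g (MvPolynomial.X i) :=
    fun i => (Ideal.Quotient.mk_surjective (g (MvPolynomial.X i))).choose_spec
  have hmon : ∀ (β : Fin s → ℕ) (v : N), (∏ i, y i ^ β i) • v =
      (MvPolynomial.monomial (Finsupp.equivFunOnFinite.symm β) (1 : k)) • v := by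
    intro β v
    change _ = g _ • v
    have : g (MvPolynomial.monomial (Finsupp.equivFunOnFinite.symm β) (1 : k)) =
        Ideal.Quotient.mk I (∏ i, y i ^ β i) := by
      rw [MvPolynomial.monomial_eq, map_prod, Finsupp.prod_fintype _ _ (by simp)]
      simp [hyg]
    rw [this]; rfl
  have hsm : ∀ (c : k) (v : N), (MvPolynomial.C c : MvPolynomial (Fin s) k) • v = c • v := by
    intro c v
    change g (algebraMap k _ c) • v = _
    rw [AlgHom.commutes, ← one_smul A v, ← smul_assoc c (1 : A) v,
      ← Algebra.algebraMap_eq_smul_one]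
    change Ideal.Quotient.mk I (algebraMap k A c) • _ = _
    rw [one_smul]; rfl
  have hexp : ∀ (f : MvPolynomial (Fin s) k) (v : N), f • v =
      ∑ β ∈ f.support, f.coeff β • (∏ i, y i ^ β i) • v := by
    intro f v
    conv_lhs => rw [f.as_sum, Finset.sum_smul]
    refine Finset.sum_congr rfl fun β _ => ?_
    rw [hmon, ← hsm, smul_smul, MvPolynomial.C_mul_monomial, mul_one,
      Finsupp.equivFunOnFinite_symm_coe]
  refine ⟨?_, ?_⟩
  · obtain ⟨t, gen, hgen⟩ := Module.Finite.exists_fin (R := MvPolynomial (Fin s) k) (M := N)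
    refine ⟨t, gen, eq_top_iff.2 fun v _ => ?_⟩
    have hv : v ∈ Submodule.span (MvPolynomial (Fin s) k) (Set.range gen) := hgen ▸ trivial
    obtain ⟨c, rfl⟩ := (Submodule.mem_span_range_iff_exists_fun _).1 hv
    refine Submodule.sum_mem _ fun l _ => ?_
    rw [hexp]
    exact Submodule.sum_mem _ fun β _ => Submodule.smul_mem _ _ (Submodule.subset_span ⟨β, l, rfl⟩)
  -- If every generator were killed by a nonzero polynomial, the product of these polynomials would
  -- annihilate N, hence vanish in A/Ann(N), against injectivity of the normalization.
  · have hv : ∃ v : N, ∀ f : MvPolynomial (Fin s) k, f • v = 0 → f = 0 := by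
      by_contra! hcon
      obtain ⟨t, gen, hgen⟩ := Module.Finite.exists_fin (R := MvPolynomial (Fin s) k) (M := N)
      choose a ha ha0 using fun l => hcon (gen l)
      have hprod : ∏ l, a l ≠ 0 := Finset.prod_ne_zero_iff.2 fun l _ => ha0 l
      apply hprod
      apply hinj
      rw [map_zero]
      have hz : ∀ v : N, g (∏ l, a l) • v = 0 := by
        intro v
        change (∏ l, a l) • v = 0
        have hv : v ∈ Submodule.span (MvPolynomial (Fin s) k) (Set.range gen) := hgen ▸ trivial
        obtain ⟨c, rfl⟩ := (Submodule.mem_span_range_iff_exists_fun _).1 hv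
        rw [Finset.smul_sum]
        refine Finset.sum_eq_zero fun l _ => ?_
        rw [smul_comm, ← Finset.prod_erase_mul _ _ (Finset.mem_univ l), mul_smul, ha, smul_zero,
          smul_zero]
      obtain ⟨b, hb⟩ := Ideal.Quotient.mk_surjective (g (∏ l, a l))
      rw [← hb] at hz ⊢
      exact Ideal.Quotient.eq_zero_iff_mem.2 (Module.mem_annihilator.2 hz)
    obtain ⟨v, hv⟩ := hv
    refine ⟨v, ?_⟩
    rw [linearIndependent_iff]
    intro l hl
    have key : (∑ β ∈ l.support,
        MvPolynomial.monomial (Finsupp.equivFunOnFinite.symm β) (l β) : MvPolynomial (Fin s) k) = 0 := by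
      apply hv
      rw [Finset.sum_smul, ← hl, Finsupp.linearCombination_apply, Finsupp.sum]
      refine Finset.sum_congr rfl fun β _ => ?_
      rw [hmon, ← hsm, smul_smul, MvPolynomial.C_mul_monomial, mul_one]
    ext β
    have := congrArg (MvPolynomial.coeff (Finsupp.equivFunOnFinite.symm β)) key
    rw [MvPolynomial.coeff_sum] at this
    simp only [MvPolynomial.coeff_monomial, EmbeddingLike.apply_eq_iff_eq, MvPolynomial.coeff_zero,
      Finset.sum_ite_eq', Finsupp.mem_support_iff] at this
    by_contra hne
    exact hne (by simpa using this)

/-- `W`, closed up `m` times under multiplication by the elements of `X`. -/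
def reach (X : Finset A) (W : Submodule k N) : ℕ → Submodule k N
  | 0 => W
  | m + 1 => reach X W m ⊔ Submodule.span k {z | ∃ x ∈ X, ∃ w ∈ reach X W m, z = x • w}

theorem reach_mono (X : Finset A) (W : Submodule k N) : Monotone (reach X W) :=
  monotone_nat_of_le_succ fun _ => le_sup_left

theorem smul_mem_reach {X : Finset A} {W : Submodule k N} {m : ℕ} {x : A} {w : N} (hx : x ∈ X)
    (hw : w ∈ reach X W m) : x • w ∈ reach X W (m + 1) :=
  Submodule.mem_sup_right (Submodule.subset_span ⟨x, hx, w, hw, rfl⟩)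

theorem pow_smul_mem_reach {X : Finset A} {W : Submodule k N} {m : ℕ} {x : A} {w : N} (hx : x ∈ X)
    (hw : w ∈ reach X W m) (e : ℕ) : x ^ e • w ∈ reach X W (m + e) := by
  induction e with
  | zero => simpa using hw
  | succ e ih => rw [pow_succ', mul_smul]; exact smul_mem_reach hx ih

theorem prod_pow_smul_mem_reach {X : Finset A} {W : Submodule k N} {m : ℕ} {w : N} {ι : Type*}
    {x : ι → A} (hx : ∀ i, x i ∈ X) (hw : w ∈ reach X W m) (T : Finset ι) (e : ι → ℕ) :
    (∏ i ∈ T, x i ^ e i) • w ∈ reach X W (m + ∑ i ∈ T, e i) := by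
  classical
  induction T using Finset.induction_on with
  | empty => simpa using hw
  | insert i T hi ih =>
    rw [Finset.prod_insert hi, Finset.sum_insert hi, mul_smul, add_comm (e i), ← add_assoc]
    exact pow_smul_mem_reach (hx i) ih _

/-- The growth of a filtration generated by finite data is at most the dimension of the support. -/
theorem exists_finrank_reach_le [Algebra.FiniteType k A] [Module.Finite A N] [Nontrivial N]
    (X : Finset A) (W : Submodule k N) [FiniteDimensional k W] {s : ℕ}
    (hs : Module.supportDim A N = s) :
    ∃ C : ℕ, ∀ m, FiniteDimensional k (reach X W m) ∧
      Module.finrank k (reach X W m) ≤ C * (m + 1) ^ s := by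
  classical
  obtain ⟨s', hs', y, ⟨t, g, hg⟩, -⟩ := exists_noether_normalization (k := k) (A := A) (N := N)
  obtain rfl : s' = s := by
    rw [hs] at hs'
    exact_mod_cast hs'.symm
  -- Comparison filtration: monomials in y with all exponents at most D, applied to the generators,
  -- so its dimension is at most t (D+1)^s.
  let U : ℕ → Submodule k N := fun D => Submodule.span k
    (Set.range fun b : (Fin s' → Fin (D + 1)) × Fin t => (∏ i, y i ^ (b.1 i : ℕ)) • g b.2)
  have memU : ∀ (D : ℕ) (β : Fin s' → ℕ) (l : Fin t), (∀ i, β i ≤ D) →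
      (∏ i, y i ^ β i) • g l ∈ U D := fun D β l h =>
    Submodule.subset_span ⟨(fun i => ⟨β i, Nat.lt_succ_of_le (h i)⟩, l), rfl⟩
  have Umono : Monotone U := by
    intro D E h
    refine Submodule.span_le.2 ?_
    rintro _ ⟨b, rfl⟩
    exact memU _ _ _ fun i => (Nat.lt_succ_iff.1 (b.1 i).2).trans h
  have Uex : ∀ v : N, ∃ D, v ∈ U D := by
    intro v
    have hv : v ∈ Submodule.span k {z | ∃ (β : Fin s' → ℕ) (l : Fin t),
      z = (∏ i, y i ^ β i) • g l} := hg ▸ trivial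
    induction hv using Submodule.span_induction with
    | mem z hz =>
      obtain ⟨β, l, rfl⟩ := hz
      exact ⟨∑ i, β i, memU _ _ _ fun i => Finset.single_le_sum (fun _ _ => Nat.zero_le _)
        (Finset.mem_univ i)⟩
    | zero => exact ⟨0, zero_mem _⟩
    | add u v _ _ hu hv =>
      obtain ⟨D, hD⟩ := hu
      obtain ⟨E, hE⟩ := hv
      exact ⟨max D E, add_mem (Umono (le_max_left _ _) hD) (Umono (le_max_right _ _) hE)⟩
    | smul c u _ hu =>
      obtain ⟨D, hD⟩ := hu
      exact ⟨D, Submodule.smul_mem _ _ hD⟩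
  have Uex' : ∀ T : Finset N, ∃ D, ∀ v ∈ T, v ∈ U D := by
    intro T
    choose D hD using Uex
    exact ⟨T.sup D, fun v hv => Umono (Finset.le_sup hv) (hD v)⟩
  have Umul : ∀ (D E : ℕ) (β : Fin s' → ℕ) (v : N), (∀ i, β i ≤ D) → v ∈ U E →
      (∏ i, y i ^ β i) • v ∈ U (D + E) := by
    intro D E β v hβ hv
    induction hv using Submodule.span_induction with
    | mem z hz =>
      obtain ⟨b, rfl⟩ := hz
      change (∏ i, y i ^ β i) • (∏ i, y i ^ (b.1 i : ℕ)) • g b.2 ∈ _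
      rw [smul_smul, ← Finset.prod_mul_distrib]
      simp_rw [← pow_add]
      exact memU _ _ _ fun i => add_le_add (hβ i) (Nat.lt_succ_iff.1 (b.1 i).2)
    | zero => rw [smul_zero]; exact zero_mem _
    | add u v _ _ hu hv => rw [smul_add]; exact add_mem hu hv
    | smul c u _ hu => rw [smul_comm]; exact Submodule.smul_mem _ _ hu
  obtain ⟨T, hT⟩ := (Submodule.fg_iff_finiteDimensional W).2 inferInstance
  -- A single E absorbs W and all products x • g l. Since A is commutative, each x ∈ X then raises
  -- the level of U by at most E.
  obtain ⟨E, hE⟩ := Uex' (T ∪ Finset.image (fun p : A × Fin t => p.1 • g p.2) (X ×ˢ Finset.univ))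
  have hW : W ≤ U E := by
    rw [← hT, Submodule.span_le]
    exact fun v hv => hE v (Finset.mem_union_left _ hv)
  have hX : ∀ x ∈ X, ∀ D, ∀ v ∈ U D, x • v ∈ U (D + E) := by
    intro x hx D v hv
    induction hv using Submodule.span_induction with
    | mem z hz =>
      obtain ⟨b, rfl⟩ := hz
      change x • (∏ i, y i ^ (b.1 i : ℕ)) • g b.2 ∈ _
      rw [smul_comm]
      refine Umul _ _ _ _ (fun i => Nat.lt_succ_iff.1 (b.1 i).2) (hE _ (Finset.mem_union_right _ ?_))
      exact Finset.mem_image.2 ⟨(x, b.2), by simp [hx], rfl⟩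
    | zero => rw [smul_zero]; exact zero_mem _
    | add u v _ _ hu hv => rw [smul_add]; exact add_mem hu hv
    | smul c u _ hu => rw [smul_comm]; exact Submodule.smul_mem _ _ hu
  have hreach : ∀ m, reach X W m ≤ U ((m + 1) * E) := by
    intro m
    induction m with
    | zero => simpa [reach] using hW
    | succ m ih =>
      refine sup_le (ih.trans (Umono (by gcongr; omega))) (Submodule.span_le.2 ?_)
      rintro _ ⟨x, hx, w, hw, rfl⟩
      have := hX x hx _ _ (ih hw)
      rwa [← Nat.succ_mul] at this
  have Ufin : ∀ D, FiniteDimensional k (U D) := fun D =>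
    FiniteDimensional.span_of_finite k (Set.finite_range _)
  refine ⟨t * (E + 1) ^ s', fun m => ⟨Submodule.finiteDimensional_of_le (hreach m), ?_⟩⟩
  calc Module.finrank k (reach X W m) ≤ Module.finrank k (U ((m + 1) * E)) :=
        Submodule.finrank_mono (hreach m)
    _ ≤ Fintype.card ((Fin s' → Fin ((m + 1) * E + 1)) × Fin t) := finrank_range_le_card _
    _ = t * ((m + 1) * E + 1) ^ s' := by simp [mul_comm]
    _ ≤ t * ((E + 1) * (m + 1)) ^ s' := by gcongr; nlinarith
    _ = _ := by rw [mul_pow, mul_assoc]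

/-- The growth of an exhaustive filtration is at least the dimension of the support. -/
theorem exists_le_finrank_filtration [Algebra.FiniteType k A] [Module.Finite A N] [Nontrivial N]
    {G : ℕ → Submodule k N} (hmono : Monotone G) [∀ m, FiniteDimensional k (G m)]
    (hex : ∀ v, ∃ m, v ∈ G m) (hsmul : ∀ a : A, ∃ E, ∀ m, ∀ v ∈ G m, a • v ∈ G (m + E)) {s : ℕ}
    (hs : Module.supportDim A N = s) :
    ∃ m₀ E : ℕ, ∀ D : ℕ, (D + 1) ^ s ≤ Module.finrank k (G (m₀ + E * D)) := by
  classical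
  obtain ⟨s', hs', y, -, v, hv⟩ := exists_noether_normalization (k := k) (A := A) (N := N)
  obtain rfl : s' = s := by
    rw [hs] at hs'
    exact_mod_cast hs'.symm
  obtain ⟨m₀, hm₀⟩ := hex v
  choose E hE using hsmul
  refine ⟨m₀, ∑ i, E (y i), fun D => ?_⟩
  have hpow : ∀ (a : A) (e m : ℕ) (w : N), w ∈ G m → a ^ e • w ∈ G (m + E a * e) := by
    intro a e
    induction e with
    | zero => intro m w hw; simpa using hw
    | succ e ih =>
      intro m w hw
      rw [pow_succ', mul_smul, Nat.mul_succ, ← add_assoc]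
      exact hE _ _ _ (ih _ _ hw)
  have hprod : ∀ (β : Fin s' → ℕ) (T : Finset (Fin s')), (∏ i ∈ T, y i ^ β i) • v ∈
      G (m₀ + ∑ i ∈ T, E (y i) * β i) := by
    intro β T
    induction T using Finset.induction_on with
    | empty => simpa using hm₀
    | insert i T hi ih =>
      rw [Finset.prod_insert hi, Finset.sum_insert hi, mul_smul, add_comm (E (y i) * _), ← add_assoc]
      exact hpow _ _ _ _ ih
  -- The (D+1)^s monomials with exponents at most D, applied to the torsion-free v, are independent;
  -- multiplication by y i costs E (y i) levels each time.
  let f : (Fin s' → Fin (D + 1)) → G (m₀ + (∑ i, E (y i)) * D) := fun b =>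
    ⟨(∏ i, y i ^ (b i : ℕ)) • v, hmono (by
      rw [Finset.sum_mul]
      gcongr
      exact Nat.lt_succ_iff.1 (b _).2) (hprod (fun i => b i) Finset.univ)⟩
  have hf : LinearIndependent k f := by
    refine LinearIndependent.of_comp (Submodule.subtype _) ?_
    exact hv.comp (fun (b : Fin s' → Fin (D + 1)) i => (b i : ℕ)) fun b b' h => by
      funext i
      exact Fin.ext (congrFun h i)
  have := hf.fintype_card_le_finrank
  simpa using this

end Growth


/-! ### Laurent polynomials acting on Hilbert functions -/

/-- The translations of functions on `ℤ`. -/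
def translate : Multiplicative ℤ →* Module.End ℤ (ℤ → ℤ) where
  toFun l := LinearMap.funLeft ℤ ℤ fun k => k - l.toAdd
  map_one' := by ext; simp [LinearMap.funLeft_apply]
  map_mul' a b := by
    refine LinearMap.ext fun f => funext fun k => ?_
    simp only [LinearMap.funLeft_apply, Module.End.mul_apply, toAdd_mul]
    congr 1
    ring

/-- `∑ a_l T^l` acts on functions by `h ↦ (k ↦ ∑ a_l h (k - l))`. -/
def convolve : ℤ[T;T⁻¹] →ₐ[ℤ] Module.End ℤ (ℤ → ℤ) :=
  AddMonoidAlgebra.lift ℤ _ ℤ translate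

theorem convolve_C_mul_T (a l : ℤ) (h : ℤ → ℤ) (k : ℤ) :
    convolve (LaurentPolynomial.C a * LaurentPolynomial.T l) h k = a * h (k - l) := by
  rw [← LaurentPolynomial.single_eq_C_mul_T]
  unfold convolve
  rw [AddMonoidAlgebra.lift_single]
  rfl

theorem convolve_T (l : ℤ) (h : ℤ → ℤ) (k : ℤ) :
    convolve (LaurentPolynomial.T l) h k = h (k - l) := by
  simpa using convolve_C_mul_T 1 l h k

theorem convolve_one_sub_T (h : ℤ → ℤ) (k : ℤ) :
    convolve (1 - LaurentPolynomial.T 1) h k = h k - h (k - 1) := by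
  rw [map_sub, map_one, LinearMap.sub_apply, Pi.sub_apply, convolve_T]
  rfl

/-- The Hilbert function `k ↦ #{β ∈ ℕ^s : |β| ≤ k}`. -/
def hilbertFn (s : ℕ) (k : ℤ) : ℤ := if 0 ≤ k then ((k.toNat + s).choose s : ℕ) else 0

/-- Pascal's rule. In terms of generating functions, `hilbertFn s` is (1-T)^{-(s+1)}. -/
theorem convolve_one_sub_T_hilbertFn (s : ℕ) :
    convolve (1 - LaurentPolynomial.T 1) (hilbertFn (s + 1)) = hilbertFn s := by
  funext k
  rw [convolve_one_sub_T]
  unfold hilbertFn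
  rcases lt_trichotomy k 0 with hk | rfl | hk
  · rw [if_neg (by omega), if_neg (by omega), if_neg (by omega), sub_zero]
  · simp
  · obtain ⟨j, rfl⟩ : ∃ j : ℕ, k = j + 1 := ⟨(k - 1).toNat, by omega⟩
    rw [if_pos (by omega), if_pos (by omega), if_pos (by omega)]
    have h1 : ((j : ℤ) + 1).toNat = j + 1 := by omega
    have h2 : ((j : ℤ) + 1 - 1).toNat = j := by omega
    rw [h1, h2, show j + 1 + (s + 1) = (j + s + 1) + 1 by ring, Nat.choose_succ_succ,
      show j + 1 + s = j + s + 1 by ring, show j + (s + 1) = j + s + 1 by ring]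
    push_cast
    ring

theorem convolve_pow_mul_hilbertFn (s e : ℕ) (Q : ℤ[T;T⁻¹]) :
    convolve ((1 - LaurentPolynomial.T 1) ^ e * Q) (hilbertFn (s + e)) =
      convolve Q (hilbertFn s) := by
  induction e with
  | zero => simp
  | succ e ih =>
    rw [pow_succ, mul_right_comm, map_mul, Module.End.mul_apply, ← add_assoc,
      convolve_one_sub_T_hilbertFn, ih]

/-- The value of a Laurent polynomial at `T = 1`. -/
def evalOne : ℤ[T;T⁻¹] →+* ℤ := LaurentPolynomial.eval₂ (RingHom.id ℤ) 1

theorem evalOne_C_mul_T (a l : ℤ) :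
    evalOne (LaurentPolynomial.C a * LaurentPolynomial.T l) = a := by
  simp [evalOne]

theorem evalOne_one_sub_T : evalOne (1 - LaurentPolynomial.T 1) = 0 := by
  have := evalOne_C_mul_T 1 1
  simp only [map_one, one_mul] at this
  rw [map_sub, map_one, this, sub_self]

/-- `hilbertFn 0` is the indicator function of k ≥ 0, so far out every translate contributes 1 and
the sum of the coefficients remains. -/
theorem eventually_convolve_hilbertFn_zero (Q : ℤ[T;T⁻¹]) :
    ∀ᶠ k : ℤ in Filter.atTop, convolve Q (hilbertFn 0) k = evalOne Q := by
  induction Q using LaurentPolynomial.induction_on' with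
  | add p q hp hq =>
    filter_upwards [hp, hq] with k hp hq
    rw [map_add, map_add, LinearMap.add_apply, Pi.add_apply, hp, hq]
  | C_mul_T l a =>
    filter_upwards [Filter.eventually_ge_atTop l] with k hk
    rw [convolve_C_mul_T, evalOne_C_mul_T, hilbertFn, if_pos (by omega)]
    simp

/-- With j = k - l ≥ 0, s! C(j+s, s) = (j+1)⋯(j+s) is a product of s factors, each asymptotic to k.
-/
theorem tendsto_hilbertFn (s : ℕ) (l : ℤ) :
    Filter.Tendsto (fun k : ℕ => (s.factorial : ℝ) * (hilbertFn s (k - l) : ℝ) / (k : ℝ) ^ s)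
      Filter.atTop (nhds 1) := by
  have key : ∀ᶠ k : ℕ in Filter.atTop,
      ∏ i ∈ Finset.range s, ((k : ℝ) + ((i + 1 : ℝ) - l)) / k =
        (s.factorial : ℝ) * (hilbertFn s (k - l) : ℝ) / (k : ℝ) ^ s := by
    filter_upwards [Filter.eventually_ge_atTop l.toNat] with k hk
    obtain ⟨j, hj⟩ : ∃ j : ℕ, (k : ℤ) - l = j := ⟨((k : ℤ) - l).toNat, by omega⟩
    have hj' : (k : ℝ) - l = j := by exact_mod_cast hj
    rw [hj, hilbertFn, if_pos (by omega), Int.toNat_natCast, Finset.prod_div_distrib,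
      Finset.prod_const, Finset.card_range]
    congr 1
    have : (s.factorial : ℝ) * ((j + s).choose s : ℝ) = ((j + 1).ascFactorial s : ℝ) := by
      rw [Nat.ascFactorial_eq_factorial_mul_choose]
      push_cast
      rfl
    push_cast
    rw [this, Nat.ascFactorial_eq_prod_range]
    push_cast
    refine Finset.prod_congr rfl fun i _ => ?_
    rw [← hj']
    ring
  refine Filter.Tendsto.congr' key ?_
  have hone : nhds (1 : ℝ) = nhds (∏ i ∈ Finset.range s, (1 : ℝ)) := by simp
  rw [hone]
  refine tendsto_finsetProd _ fun i _ => ?_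
  have h1 : Filter.Tendsto (fun k : ℕ => 1 + ((i + 1 : ℝ) - l) / (k : ℝ)) Filter.atTop
      (nhds (1 + 0)) :=
    tendsto_const_nhds.add (tendsto_const_div_atTop_nhds_zero_nat _)
  rw [add_zero] at h1
  refine h1.congr' ?_
  filter_upwards [Filter.eventually_gt_atTop 0] with k hk
  have : (k : ℝ) ≠ 0 := by positivity
  field_simp

theorem tendsto_convolve_hilbertFn (s : ℕ) (Q : ℤ[T;T⁻¹]) :
    Filter.Tendsto
      (fun k : ℕ => (s.factorial : ℝ) * (convolve Q (hilbertFn s) k : ℝ) / (k : ℝ) ^ s)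
      Filter.atTop (nhds (evalOne Q : ℝ)) := by
  induction Q using LaurentPolynomial.induction_on' with
  | add p q hp hq =>
    rw [map_add evalOne, Int.cast_add]
    refine (hp.add hq).congr fun k => ?_
    rw [map_add, LinearMap.add_apply, Pi.add_apply]
    push_cast
    ring
  | C_mul_T l a =>
    rw [evalOne_C_mul_T]
    have := (tendsto_hilbertFn s l).const_mul (a : ℝ)
    rw [mul_one] at this
    refine this.congr fun k => ?_
    rw [convolve_C_mul_T]
    push_cast
    ring

/-- Applying 1-T altogether s+1 times turns `hilbertFn s` into the delta function at 0, and
convolution with the delta function reads off the coefficients. -/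
theorem eq_zero_of_convolve_hilbertFn_eq_zero {s : ℕ} {Q : ℤ[T;T⁻¹]}
    (h : convolve Q (hilbertFn s) = 0) : Q = 0 := by
  have h0 : convolve Q (hilbertFn 0) = 0 := by
    rw [← convolve_pow_mul_hilbertFn 0 s, zero_add, map_mul, Module.End.mul_apply, h, map_zero]
  have h1 : convolve Q (convolve (1 - LaurentPolynomial.T 1) (hilbertFn 0)) = 0 := by
    rw [← Module.End.mul_apply, ← map_mul, mul_comm, map_mul, Module.End.mul_apply, h0, map_zero]
  have h2 : convolve (1 - LaurentPolynomial.T 1) (hilbertFn 0) = Pi.single 0 1 := by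
    funext k
    rw [convolve_one_sub_T, Pi.single_apply]
    unfold hilbertFn
    rcases lt_trichotomy k 0 with hk | rfl | hk
    · rw [if_neg (by omega), if_neg (by omega), if_neg (by omega)]; rfl
    · simp
    · rw [if_pos (by omega), if_pos (by omega), if_neg (by omega)]; simp
  have h3 : ∀ (P : ℤ[T;T⁻¹]) (k : ℤ), convolve P (Pi.single 0 1) k = P.coeff k := by
    intro P k
    induction P using LaurentPolynomial.induction_on' with
    | add p q hp hq =>
      rw [map_add, LinearMap.add_apply, Pi.add_apply, hp, hq]; rfl
    | C_mul_T l a =>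
      rw [convolve_C_mul_T, ← LaurentPolynomial.single_eq_C_mul_T, AddMonoidAlgebra.coeff_single,
        Finsupp.single_apply, Pi.single_apply]
      by_cases hkl : l = k
      · simp [hkl]
      · rw [if_neg (by omega), if_neg hkl, mul_zero]
  refine LaurentPolynomial.ext fun k => ?_
  rw [← h3, ← h2, h1]
  rfl

/-- The factor theorem at T = 1. Negative exponents reduce to positive ones by 1 - T^{-j} = -(1 -
T^j) T^{-j}. -/
theorem one_sub_T_dvd_sub_evalOne (P : ℤ[T;T⁻¹]) :
    (1 - LaurentPolynomial.T 1) ∣ P - LaurentPolynomial.C (evalOne P) := by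
  induction P using LaurentPolynomial.induction_on' with
  | add p q hp hq =>
    rw [map_add, map_add]
    convert! dvd_add hp hq using 1
    ring
  | C_mul_T l a =>
    rw [evalOne_C_mul_T]
    have hpow : ∀ j : ℕ, (1 - LaurentPolynomial.T 1 : ℤ[T;T⁻¹]) ∣ 1 - LaurentPolynomial.T j := by
      intro j
      have := sub_dvd_pow_sub_pow (1 : ℤ[T;T⁻¹]) (LaurentPolynomial.T 1) j
      simpa using this
    have hT : (1 - LaurentPolynomial.T 1 : ℤ[T;T⁻¹]) ∣ 1 - LaurentPolynomial.T l := by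
      obtain ⟨j, rfl | rfl⟩ := l.eq_nat_or_neg
      · exact hpow j
      · have h : (1 - LaurentPolynomial.T (-(j : ℤ)) : ℤ[T;T⁻¹]) =
            (1 - LaurentPolynomial.T (j : ℤ)) * -LaurentPolynomial.T (-(j : ℤ)) := by
          rw [mul_neg, sub_mul, one_mul, ← LaurentPolynomial.T_add, add_neg_cancel,
            LaurentPolynomial.T_zero, neg_sub]
        rw [h]
        exact Dvd.dvd.mul_right (hpow j) _
    have := (hT.mul_left (LaurentPolynomial.C a)).neg_right
    convert! this using 1
    ring

theorem substOneSub_one_sub_T : substOneSub (1 - LaurentPolynomial.T 1) = PowerSeries.X := by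
  have : substOneSub (LaurentPolynomial.T 1) = 1 - PowerSeries.X := by
    have h := LaurentPolynomial.eval₂_T_n (Int.castRingHom (PowerSeries ℤ)) oneSubT 1
    rw [pow_one] at h
    exact h
  rw [map_sub, map_one, this, sub_sub_cancel]

theorem constantCoeff_substOneSub (P : ℤ[T;T⁻¹]) :
    PowerSeries.constantCoeff (substOneSub P) = evalOne P := by
  obtain ⟨Q, hQ⟩ := one_sub_T_dvd_sub_evalOne P
  have hC : substOneSub (LaurentPolynomial.C (evalOne P)) = (evalOne P : PowerSeries ℤ) :=
    LaurentPolynomial.eval₂_C _ _ _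
  rw [sub_eq_iff_eq_add] at hQ
  conv_lhs => rw [hQ]
  rw [map_add, map_mul, substOneSub_one_sub_T, hC]
  simp

/-- The substitution sends 1-T to X and the value at T = 1 to the constant coefficient. Each
vanishing coefficient thus lets one more factor 1-T be split off, with no need for injectivity of
the substitution. -/
theorem exists_eq_pow_mul_of_coeff_eq_zero (P : ℤ[T;T⁻¹]) (e : ℕ)
    (h : ∀ i < e, PowerSeries.coeff i (substOneSub P) = 0) :
    ∃ Q, P = (1 - LaurentPolynomial.T 1) ^ e * Q ∧
      evalOne Q = PowerSeries.coeff e (substOneSub P) := by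
  induction e with
  | zero => exact ⟨P, by simp, by rw [← constantCoeff_substOneSub]; simp⟩
  | succ e ih =>
    obtain ⟨Q, hQ, hQe⟩ := ih fun i hi => h i (by omega)
    rw [h e (by omega)] at hQe
    obtain ⟨Q', hQ'⟩ := one_sub_T_dvd_sub_evalOne Q
    rw [hQe, map_zero, sub_zero] at hQ'
    refine ⟨Q', by rw [hQ, hQ', pow_succ, mul_assoc], ?_⟩
    rw [hQ, hQ', ← mul_assoc, ← pow_succ, map_mul, map_pow, substOneSub_one_sub_T,
      ← constantCoeff_substOneSub]
    have := PowerSeries.coeff_X_pow_mul (substOneSub Q') (e + 1) 0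
    simpa using this.symm

/-- A nonnegative increasing function whose generating function is `K(T) / (1 - T)^(n + 1)` grows as
the least term `m T^d` of `K(1 - T)` predicts. -/
theorem growth_of_leastTerm {n : ℕ} {K : ℤ[T;T⁻¹]} {d : ℕ} {m : ℤ}
    (hK : leastTerm (substOneSub K) = Polynomial.monomial d m) {h : ℤ → ℕ} (hmono : Monotone h)
    (hh : ∀ k, (h k : ℤ) = convolve K (hilbertFn n) k) :
    (m = 0 → ∀ k, h k = 0) ∧
    (m ≠ 0 → d ≤ n ∧
      Filter.Tendsto (fun k : ℕ => ((n - d).factorial : ℝ) * (h k : ℝ) / (k : ℝ) ^ (n - d))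
        Filter.atTop (nhds (m : ℝ)) ∧
      (d = n → ∀ᶠ k in Filter.atTop, (h k : ℤ) = m)) := by
  -- Here K(T)/(1-T)^{n+1} is a Laurent polynomial, so h vanishes far out; being monotone with
  -- values in ℕ, it vanishes everywhere.
  have hzero : ∀ Q, K = (1 - LaurentPolynomial.T 1) ^ (n + 1) * Q → ∀ k, h k = 0 := by
    intro Q hQ k
    have hev := eventually_convolve_hilbertFn_zero ((1 - LaurentPolynomial.T 1) * Q)
    obtain ⟨k', hk', hkk'⟩ := (hev.and (Filter.eventually_ge_atTop k)).exists
    rw [← convolve_pow_mul_hilbertFn 0 n, ← mul_assoc, ← pow_succ, ← hQ, zero_add, ← hh, map_mul,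
      evalOne_one_sub_T, zero_mul] at hk'
    have := hmono hkk'
    omega
  have hlt : ∀ i < (substOneSub K).order.toNat, PowerSeries.coeff i (substOneSub K) = 0 := by
    intro i hi
    apply PowerSeries.coeff_of_lt_order
    by_contra! hle
    have := ENat.toNat_le_of_le_natCast hle
    omega
  unfold leastTerm at hK
  constructor
  · rintro rfl
    rw [Polynomial.monomial_zero_right, Polynomial.monomial_eq_zero_iff] at hK
    have hs : substOneSub K = 0 := by
      by_contra hne
      exact PowerSeries.coeff_order hne hK
    obtain ⟨Q, hQ, -⟩ := exists_eq_pow_mul_of_coeff_eq_zero K (n + 1) (by simp [hs])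
    exact hzero Q hQ
  · intro hm
    have hne : PowerSeries.coeff (substOneSub K).order.toNat (substOneSub K) ≠ 0 := by
      intro h0
      rw [h0, Polynomial.monomial_zero_right] at hK
      exact hm ((Polynomial.monomial_eq_zero_iff _ _).1 hK.symm)
    -- A nonzero monomial determines its degree and its coefficient, so d is the order of K(1-T) and
    -- m its leading coefficient.
    obtain ⟨hd, hc⟩ : (substOneSub K).order.toNat = d ∧
        PowerSeries.coeff (substOneSub K).order.toNat (substOneSub K) = m := by
      have h1 := congrArg Polynomial.natDegree hK
      rw [Polynomial.natDegree_monomial_eq _ hne, Polynomial.natDegree_monomial_eq _ hm] at h1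
      refine ⟨h1, ?_⟩
      rw [h1] at hK ⊢
      exact Polynomial.monomial_injective _ hK
    rw [hd] at hlt hc
    obtain ⟨Q, hQ, hQm⟩ := exists_eq_pow_mul_of_coeff_eq_zero K d hlt
    rw [hc] at hQm
    -- For d > n, h = 0 by the above, hence K = 0, whose least term is 0.
    have hdn : d ≤ n := by
      by_contra! hnd
      obtain ⟨e, rfl⟩ := Nat.exists_eq_add_of_lt hnd
      have h0 := hzero ((1 - LaurentPolynomial.T 1) ^ e * Q) (by rw [hQ]; ring)
      have hK0 : K = 0 := eq_zero_of_convolve_hilbertFn_eq_zero (s := n) (by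
        funext k
        rw [← hh, h0]; rfl)
      rw [hK0] at hne
      simp at hne
    have hconv : ∀ k, (h k : ℤ) = convolve Q (hilbertFn (n - d)) k := by
      intro k
      rw [hh, hQ, ← convolve_pow_mul_hilbertFn (n - d) d, Nat.sub_add_cancel hdn]
    refine ⟨hdn, ?_, ?_⟩
    · rw [← hQm]
      refine (tendsto_convolve_hilbertFn (n - d) Q).congr fun k => ?_
      rw [← hconv]
      simp
    · rintro rfl
      filter_upwards [eventually_convolve_hilbertFn_zero Q] with k hk
      rw [hconv, Nat.sub_self, hk, hQm]


/-! ### Standard monomials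

A spanning family `e` of an `R`-module, indexed by a well-ordered set, contains a linearly independent
subfamily of "standard" elements that spans up to torsion. If `e` consists of the monomial multiples of
finitely many elements, the torsion can be bounded by a single denominator `q`. -/

section Standard

variable {R G B Γ : Type*} [CommRing R] [IsDomain R] [AddCommGroup G] [Module R G]
  [LinearOrder Γ] [WellFoundedLT Γ] (e : B → G) (key : B → Γ)

/-- Up to torsion, `e b` is a combination of smaller members of the family. -/
def IsLeading (b : B) : Prop :=
  ∃ c : R, c ≠ 0 ∧ c • e b ∈ Submodule.span R (e '' {b' | key b' < key b})

/-- In a nontrivial relation, the member of largest key with nonzero coefficient would be leading.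
-/
theorem linearIndependent_standard (hkey : Function.Injective key) :
    LinearIndependent R (fun b : {b // ¬ IsLeading (R := R) e key b} => e b) := by
  classical
  rw [linearIndependent_iff']
  intro s g hg
  by_contra! hcon
  obtain ⟨b₀, hb₀, hgb₀⟩ := hcon
  obtain ⟨b, hb, hmax⟩ := (s.filter fun b => g b ≠ 0).exists_max_image (fun b => key b)
    ⟨b₀, Finset.mem_filter.2 ⟨hb₀, hgb₀⟩⟩
  rw [Finset.mem_filter] at hb
  refine b.2 ⟨g b, hb.2, ?_⟩
  rw [← Finset.add_sum_erase _ _ hb.1, add_eq_zero_iff_eq_neg] at hg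
  rw [hg]
  refine neg_mem (Submodule.sum_mem _ fun b' hb' => ?_)
  rw [Finset.mem_erase] at hb'
  by_cases hz : g b' = 0
  · rw [hz, zero_smul]; exact zero_mem _
  · refine Submodule.smul_mem _ _ (Submodule.subset_span ⟨b', ?_, rfl⟩)
    refine lt_of_le_of_ne (hmax b' (Finset.mem_filter.2 ⟨hb'.2, hz⟩)) fun h => ?_
    exact hb'.1 (Subtype.ext (hkey h))

theorem exists_pow_smul_mem_of_mem_span {q : R} {T : Set B} {P : Submodule R G}
    (h : ∀ b ∈ T, ∃ N : ℕ, q ^ N • e b ∈ P) {v : G} (hv : v ∈ Submodule.span R (e '' T)) :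
    ∃ N : ℕ, q ^ N • v ∈ P := by
  induction hv using Submodule.span_induction with
  | mem z hz =>
    obtain ⟨b, hb, rfl⟩ := hz
    exact h b hb
  | zero => exact ⟨0, by simp⟩
  | add u v _ _ hu hv =>
    obtain ⟨N, hN⟩ := hu
    obtain ⟨N', hN'⟩ := hv
    refine ⟨N + N', ?_⟩
    rw [smul_add]
    refine add_mem ?_ ?_
    · rw [add_comm, pow_add, mul_smul]; exact P.smul_mem _ hN
    · rw [pow_add, mul_smul]; exact P.smul_mem _ hN'
  | smul c u _ hu =>
    obtain ⟨N, hN⟩ := hu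
    exact ⟨N, by rw [smul_comm]; exact P.smul_mem _ hN⟩

/-- Well-founded rewriting of leading members by smaller ones. The exponent of q may grow with b,
which is harmless: specialization only needs q itself to stay nonzero. -/
theorem exists_pow_smul_mem_span_standard {q : R}
    (hq : ∀ b, IsLeading (R := R) e key b → q • e b ∈ Submodule.span R (e '' {b' | key b' < key b}))
    (b : B) : ∃ N : ℕ, q ^ N • e b ∈
      Submodule.span R (e '' {b' | ¬ IsLeading (R := R) e key b' ∧ key b' ≤ key b}) := by
  induction hk : key b using WellFoundedLT.induction generalizing b with
  | ind x ih =>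
    subst hk
    by_cases hb : IsLeading (R := R) e key b
    · obtain ⟨N, hN⟩ := exists_pow_smul_mem_of_mem_span e (q := q)
        (P := Submodule.span R (e '' {b' | ¬ IsLeading (R := R) e key b' ∧ key b' ≤ key b}))
        (fun b' hb' => by
          obtain ⟨N, hN⟩ := ih (key b') hb' b' rfl
          exact ⟨N, Submodule.span_mono (Set.image_mono fun b'' h =>
            (⟨h.1, h.2.trans (le_of_lt hb')⟩ : _ ∧ _)) hN⟩) (hq b hb)
      exact ⟨N + 1, by rwa [pow_succ, mul_smul]⟩
    · exact ⟨0, by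
        rw [pow_zero, one_smul]
        exact Submodule.subset_span ⟨b, ⟨hb, le_rfl⟩, rfl⟩⟩

end Standard

/-- Dickson's lemma: the minimal elements form an antichain in a well-quasi-order, hence a finite
set. -/
theorem exists_finset_le_of_mem {n : ℕ} (Λ : Set (Fin n →₀ ℕ)) :
    ∃ T : Finset (Fin n →₀ ℕ), (∀ β ∈ T, β ∈ Λ) ∧ ∀ β ∈ Λ, ∃ β' ∈ T, β' ≤ β := by
  have hfin : {β | Minimal (· ∈ Λ) β}.Finite :=
    WellQuasiOrderedLE.finite_of_isAntichain (setOfPred_minimal_antichain _)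
  refine ⟨hfin.toFinset, fun β hβ => (hfin.mem_toFinset.1 hβ).1, fun β hβ => ?_⟩
  obtain ⟨β', hle, hmin⟩ := (Set.isPWO_of_wellQuasiOrderedLE Λ).exists_le_minimal hβ
  exact ⟨β', hfin.mem_toFinset.2 hmin, hle⟩

/-- A Gröbner basis argument over a domain: the leading exponents in each component are stable under
adding exponents, so the denominators of finitely many minimal leading monomials suffice. -/
theorem exists_standard {R G : Type*} [CommRing R] [IsDomain R] [AddCommGroup G] [Module R G]
    {n r : ℕ} (e : Fin r × (Fin n →₀ ℕ) → G) (x : (Fin n →₀ ℕ) → G →ₗ[R] G)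
    (hx : ∀ γ j β, x γ (e (j, β)) = e (j, γ + β)) (N : Fin r → ℕ) :
    ∃ (Std : Set (Fin r × (Fin n →₀ ℕ))) (q : R), q ≠ 0 ∧
      LinearIndependent R (fun b : Std => e b) ∧
      ∀ b, ∃ k : ℕ, q ^ k • e b ∈
        Submodule.span R (e '' {b' | b' ∈ Std ∧ N b'.1 + b'.2.degree ≤ N b.1 + b.2.degree}) := by
  classical
  -- The weighted degree is compared first, so that rewriting never raises it; the lexicographic
  -- order and the component break ties compatibly with multiplication by monomials.
  let key : Fin r × (Fin n →₀ ℕ) → ℕ ×ₗ (Lex (Fin n →₀ ℕ) ×ₗ Fin r) := fun b =>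
    toLex (N b.1 + b.2.degree, toLex (toLex b.2, b.1))
  have hinj : Function.Injective key := by
    rintro ⟨j, β⟩ ⟨j', β'⟩ h
    simp only [key, EmbeddingLike.apply_eq_iff_eq, Prod.mk.injEq] at h
    rw [h.2.1, h.2.2]
  have hshift : ∀ γ j β j' β', key (j, β) < key (j', β') → key (j, γ + β) < key (j', γ + β') := by
    intro γ j β j' β' h
    simp only [key, Prod.Lex.toLex_lt_toLex, map_add, toLex_add] at h ⊢
    rcases h with h | ⟨h, h' | ⟨h', h''⟩⟩
    · left; omega
    · right; exact ⟨by omega, Or.inl (by simpa using h')⟩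
    · right; exact ⟨by omega, Or.inr ⟨by rw [h'], h''⟩⟩
  -- Multiplying a rewriting relation by a monomial gives a rewriting relation with the same
  -- denominator.
  have hmul : ∀ γ j β (c : R), c • e (j, β) ∈ Submodule.span R (e '' {b' | key b' < key (j, β)}) →
      c • e (j, γ + β) ∈ Submodule.span R (e '' {b' | key b' < key (j, γ + β)}) := by
    intro γ j β c h
    have h1 := Submodule.mem_map_of_mem (f := x γ) h
    rw [map_smul, hx, Submodule.map_span] at h1
    refine Submodule.span_mono ?_ h1
    rintro _ ⟨_, ⟨⟨j', β'⟩, hb, rfl⟩, rfl⟩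
    exact ⟨(j', γ + β'), hshift _ _ _ _ _ hb, (hx _ _ _).symm⟩
  have hT := fun j => exists_finset_le_of_mem {β | IsLeading (R := R) e key (j, β)}
  choose T hTΛ hT using hT
  choose! c hc0 hc using fun (j : Fin r) (β : Fin n →₀ ℕ) (h : IsLeading (R := R) e key (j, β)) => h
  let q : R := ∏ j, ∏ β ∈ T j, c j β
  refine ⟨{b | ¬ IsLeading (R := R) e key b}, q, ?_, linearIndependent_standard e key hinj, ?_⟩
  · exact Finset.prod_ne_zero_iff.2 fun j _ => Finset.prod_ne_zero_iff.2 fun β hβ =>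
      hc0 j β (hTΛ j β hβ)
  · have hq : ∀ b, IsLeading (R := R) e key b →
        q • e b ∈ Submodule.span R (e '' {b' | key b' < key b}) := by
      rintro ⟨j, β⟩ hb
      obtain ⟨β', hβ', hle⟩ := hT j β hb
      obtain ⟨γ, rfl⟩ := exists_add_of_le hle
      rw [add_comm β' γ]
      have h1 := hmul γ j β' _ (hc j β' (hTΛ j β' hβ'))
      obtain ⟨a, ha⟩ : c j β' ∣ q := (Finset.dvd_prod_of_mem _ hβ').trans
        (Finset.dvd_prod_of_mem (fun j => ∏ β ∈ T j, c j β) (Finset.mem_univ j))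
      rw [ha, mul_comm, mul_smul]
      exact Submodule.smul_mem _ _ h1
    intro b
    obtain ⟨k, hk⟩ := exists_pow_smul_mem_span_standard e key hq b
    refine ⟨k, Submodule.span_mono (Set.image_mono fun b' hb' =>
      (⟨hb'.1, ?_⟩ : _ ∧ _)) hk⟩
    exact (Prod.Lex.toLex_le_toLex'.1 hb'.2).1

/-! ### Specialization of standard monomials -/

section Specialization

variable {R G B k Φ : Type*} [CommRing R] [IsDomain R] [AddCommGroup G] [Module R G] [Field k]
  [AddCommGroup Φ] [Module k Φ] {e : B → G} {Std : Set B} {q : R} {ev : R →+* k}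
  {π : G →ₛₗ[ev] Φ}

/-- A relation in the fiber lifts to an element of (ker ev) G. After multiplication by a power of q
it becomes a combination of standard elements with coefficients in ker ev; uniqueness of
coefficients over R identifies these with q^N times the lifted ones, and ev q ≠ 0. -/
theorem linearIndependent_specialization (hStd : LinearIndependent R (fun b : Std => e b))
    (hspan : ∀ v : G, ∃ N : ℕ, q ^ N • v ∈ Submodule.span R (e '' Std)) (hq : ev q ≠ 0)
    (hev : Function.Surjective ev)
    (hker : ∀ v, π v = 0 → v ∈ RingHom.ker ev • (⊤ : Submodule R G)) :
    LinearIndependent k (fun b : Std => π (e b)) := by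
  classical
  have key : ∀ v ∈ RingHom.ker ev • (⊤ : Submodule R G), ∃ (N : ℕ) (l : Std →₀ R),
      (∀ b, ev (l b) = 0) ∧ q ^ N • v = Finsupp.linearCombination R (fun b : Std => e b) l := by
    intro v hv
    refine Submodule.smul_induction_on hv (fun a ha g _ => ?_) fun u v hu hv => ?_
    · obtain ⟨N, hN⟩ := hspan g
      rw [Set.image_eq_range, Finsupp.mem_span_range_iff_exists_finsupp] at hN
      obtain ⟨l, hl⟩ := hN
      refine ⟨N, a • l, fun b => ?_, ?_⟩
      · rw [Finsupp.smul_apply, smul_eq_mul, map_mul, RingHom.mem_ker.1 ha, zero_mul]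
      · rw [map_smul, smul_comm, ← hl]
        rfl
    · obtain ⟨N, l, hl, h⟩ := hu
      obtain ⟨N', l', hl', h'⟩ := hv
      refine ⟨N + N', q ^ N' • l + q ^ N • l', fun b => ?_, ?_⟩
      · simp [hl, hl']
      · rw [map_add, map_smul, map_smul, ← h, ← h', smul_smul, smul_smul, smul_add, pow_add,
          mul_comm (q ^ N')]
  rw [linearIndependent_iff']
  intro s g hg b hb
  choose a ha using hev
  have hv : π (∑ b ∈ s, a (g b) • e b) = 0 := by
    rw [map_sum, ← hg]
    refine Finset.sum_congr rfl fun b _ => ?_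
    rw [LinearMap.map_smulₛₗ, ha]
  obtain ⟨N, l, hl, h⟩ := key _ (hker _ hv)
  have hl' : l = ∑ b ∈ s, Finsupp.single b (q ^ N * a (g b)) := by
    apply hStd
    rw [← h, map_sum, Finset.smul_sum]
    refine Finset.sum_congr rfl fun b _ => ?_
    rw [Finsupp.linearCombination_single, mul_smul]
  have h1 := hl b
  rw [hl', Finsupp.finsetSum_apply, Finset.sum_eq_single b, Finsupp.single_eq_same, map_mul, ha,
    map_pow] at h1
  · exact (mul_eq_zero.1 h1).resolve_left (pow_ne_zero _ hq)
  · intro b' _ hne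
    exact Finsupp.single_eq_of_ne hne.symm
  · intro h; exact absurd hb h

theorem mem_span_specialization (hq : ev q ≠ 0) {T : Set B} {v : G} {N : ℕ}
    (h : q ^ N • v ∈ Submodule.span R (e '' T)) :
    π v ∈ Submodule.span k ((fun b => π (e b)) '' T) := by
  have h1 : ∀ w ∈ Submodule.span R (e '' T), π w ∈ Submodule.span k ((fun b => π (e b)) '' T) := by
    intro w hw
    induction hw using Submodule.span_induction with
    | mem z hz =>
      obtain ⟨b, hb, rfl⟩ := hz
      exact Submodule.subset_span ⟨b, hb, rfl⟩
    | zero => rw [map_zero]; exact zero_mem _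
    | add u v _ _ hu hv => rw [map_add]; exact add_mem hu hv
    | smul c u _ hu => rw [LinearMap.map_smulₛₗ]; exact Submodule.smul_mem _ _ hu
  have h2 := h1 _ h
  rw [LinearMap.map_smulₛₗ, map_pow] at h2
  have := Submodule.smul_mem _ ((ev q ^ N)⁻¹) h2
  rwa [smul_smul, inv_mul_cancel₀ (pow_ne_zero _ hq), one_smul] at this

end Specialization


/-! ### Rank of the order filtration of the Weyl algebra -/

section WeylRank

variable {n : ℕ}

/-- The action of the Weyl algebra on `ℂ[x]`. -/
def weylToEnd (n : ℕ) : Weyl n →ₐ[ℂ] Module.End ℂ (PolyX n) := (weylSubalgebra n).val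

theorem weylToEnd_del (i : Fin n) (f : PolyX n) :
    weylToEnd n (del i) f = MvPolynomial.pderiv i f := rfl

theorem weylToEnd_smul (p : PolyX n) (P : Weyl n) (f : PolyX n) :
    weylToEnd n (p • P) f = p * weylToEnd n P f := rfl

theorem weylToEnd_del_pow_monomial (i : Fin n) (e : ℕ) (α : Fin n →₀ ℕ) (a : ℂ) :
    weylToEnd n (del i ^ e) (MvPolynomial.monomial α a) =
      MvPolynomial.monomial (α - Finsupp.single i e) (a * (α i).descFactorial e) := by
  induction e with
  | zero => simp
  | succ e ih =>
    rw [pow_succ', map_mul, Module.End.mul_apply, ih, weylToEnd_del, MvPolynomial.pderiv_monomial,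
      Nat.descFactorial_succ, tsub_tsub, ← Finsupp.single_add]
    congr 1
    simp only [Finsupp.coe_tsub, Pi.sub_apply, Finsupp.single_eq_same]
    push_cast
    ring

/-- Exponents of variables outside the list are tracked because, for a list without repetitions, ∂_i
still meets the original exponent of x_i. -/
theorem weylToEnd_list_prod_monomial (β : Fin n → ℕ) (l : List (Fin n)) (hl : l.Nodup)
    (α : Fin n →₀ ℕ) :
    ∃ γ : Fin n →₀ ℕ, (∀ i ∉ l, γ i = α i) ∧
      weylToEnd n (l.map fun i => del i ^ β i).prod (MvPolynomial.monomial α 1) =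
      MvPolynomial.monomial γ ((l.map fun i => ((α i).descFactorial (β i) : ℂ)).prod) := by
  induction l with
  | nil => exact ⟨α, by simp, by simp⟩
  | cons i l ih =>
    obtain ⟨γ, hγ, h⟩ := ih hl.of_cons
    have hi : i ∉ l := (List.nodup_cons.1 hl).1
    refine ⟨γ - Finsupp.single i (β i), fun j hj => ?_, ?_⟩
    · rw [List.mem_cons, not_or] at hj
      rw [Finsupp.tsub_apply, Finsupp.single_eq_of_ne hj.1, hγ j hj.2, tsub_zero]
    · rw [List.map_cons, List.prod_cons, map_mul, Module.End.mul_apply, h,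
        weylToEnd_del_pow_monomial, List.map_cons, List.prod_cons, hγ i hi, mul_comm]

theorem delPow_eq (β : Fin n → ℕ) : delPow β = ((List.finRange n).map fun i => del i ^ β i).prod := by
  rw [delPow, List.ofFn_eq_map]

theorem weylToEnd_delPow_monomial (β : Fin n → ℕ) (α : Fin n →₀ ℕ) :
    ∃ γ : Fin n →₀ ℕ, weylToEnd n (delPow β) (MvPolynomial.monomial α 1) =
      MvPolynomial.monomial γ (∏ i, ((α i).descFactorial (β i) : ℂ)) := by
  obtain ⟨γ, -, h⟩ := weylToEnd_list_prod_monomial β _ (List.nodup_finRange n) α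
  refine ⟨γ, ?_⟩
  rw [delPow_eq, h, ← List.ofFn_eq_map, List.prod_ofFn]

/-- Apply a relation to x^β with β minimal among the exponents that occur: ∂^{β'} x^β = 0 unless β'
≤ β, so only β! times the coefficient of ∂^β survives. -/
theorem linearIndependent_delPow : LinearIndependent (PolyX n) (delPow : (Fin n → ℕ) → Weyl n) := by
  classical
  rw [linearIndependent_iff']
  intro s g hg
  by_contra! hcon
  obtain ⟨β₀, hβ₀, hgβ₀⟩ := hcon
  obtain ⟨β, hβ⟩ := (s.filter fun β => g β ≠ 0).exists_minimal
    ⟨β₀, Finset.mem_filter.2 ⟨hβ₀, hgβ₀⟩⟩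
  have hβs := Finset.mem_filter.1 hβ.1
  have h1 := congrArg (fun P => weylToEnd n P
    (MvPolynomial.monomial (Finsupp.equivFunOnFinite.symm β) 1)) hg
  simp only [map_sum, map_zero, LinearMap.sum_apply, LinearMap.zero_apply, weylToEnd_smul] at h1
  rw [Finset.sum_eq_single β] at h1
  · obtain ⟨γ, hγ⟩ := weylToEnd_delPow_monomial β (Finsupp.equivFunOnFinite.symm β)
    rw [hγ, mul_eq_zero] at h1
    refine hβs.2 (h1.resolve_right fun h => ?_)
    rw [MvPolynomial.monomial_eq_zero, Finset.prod_eq_zero_iff] at h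
    obtain ⟨i, -, hi⟩ := h
    simp [Nat.descFactorial_self, Nat.factorial_ne_zero] at hi
  · intro β' hβ' hne
    by_cases hz : g β' = 0
    · rw [hz, zero_mul]
    · have hnle : ¬ β' ≤ β := fun hle => hne
        (le_antisymm hle (hβ.2 (Finset.mem_filter.2 ⟨hβ', hz⟩) hle))
      rw [Pi.le_def] at hnle
      push Not at hnle
      obtain ⟨i, hi⟩ := hnle
      obtain ⟨γ, hγ⟩ := weylToEnd_delPow_monomial β' (Finsupp.equivFunOnFinite.symm β)
      rw [hγ, Finset.prod_eq_zero (Finset.mem_univ i), map_zero, mul_zero]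
      simpa using Nat.descFactorial_of_lt hi
  · intro h; exact absurd hβs.1 h

/-- The multi-indices are counted by total degree, and the numbers of multisets add up to one
binomial coefficient. -/
theorem card_multiIndex_le (n : ℕ) (k : ℤ) :
    ∃ T : Finset (Fin n → ℕ), (∀ β, β ∈ T ↔ ((∑ i, β i : ℕ) : ℤ) ≤ k) ∧
      (T.card : ℤ) = hilbertFn n k := by
  classical
  unfold hilbertFn
  split_ifs with hk
  · obtain ⟨k, rfl⟩ := Int.eq_ofNat_of_zero_le hk
    refine ⟨(Finset.range (k + 1)).biUnion fun j =>
      (Finset.univ.finsuppAntidiag j).map Finsupp.equivFunOnFinite.toEmbedding, fun β => ?_, ?_⟩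
    · simp only [Finset.mem_biUnion, Finset.mem_range, Finset.mem_map, Finset.mem_finsuppAntidiag]
      constructor
      · rintro ⟨j, hj, γ, ⟨hγ, -⟩, rfl⟩
        have : (∑ i, γ i : ℕ) = j := hγ
        have h2 : (∑ i, (Finsupp.equivFunOnFinite.toEmbedding γ) i : ℕ) = j := this
        rw [h2]
        omega
      · intro h
        refine ⟨∑ i, β i, by omega, Finsupp.equivFunOnFinite.symm β, ⟨rfl, by simp⟩, ?_⟩
        simp
    · rw [Finset.card_biUnion]
      · simp only [Finset.card_map, Finset.card_finsuppAntidiag_nat_eq_multichoose,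
          Finset.card_univ, Fintype.card_fin, Nat.sum_range_multichoose, Int.toNat_natCast]
      · intro j _ j' _ hjj'
        rw [Function.onFun, Finset.disjoint_left]
        intro β h h'
        simp only [Finset.mem_map, Finset.mem_finsuppAntidiag] at h h'
        obtain ⟨γ, ⟨hγ, -⟩, rfl⟩ := h
        obtain ⟨γ', ⟨hγ', -⟩, he⟩ := h'
        have := Finsupp.equivFunOnFinite.toEmbedding.injective he
        subst this
        exact hjj' (hγ.symm.trans hγ')
  · exact ⟨∅, fun β => by simp only [Finset.notMem_empty, false_iff]; omega, by simp⟩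

theorem orderF_eq_span {k : ℤ} {T : Finset (Fin n → ℕ)}
    (hT : ∀ β, β ∈ T ↔ ((∑ i, β i : ℕ) : ℤ) ≤ k) :
    orderF n k = Submodule.span (PolyX n) (Set.range fun β : T => delPow (β : Fin n → ℕ)) := by
  unfold orderF
  congr 1
  ext P
  constructor
  · rintro ⟨β, hβ, rfl⟩
    exact ⟨⟨β, (hT β).2 hβ⟩, rfl⟩
  · rintro ⟨β, rfl⟩
    exact ⟨β, (hT _).1 β.2, rfl⟩

theorem free_finite_finrank_orderF (n : ℕ) (k : ℤ) :
    Module.Free (PolyX n) (orderF n k) ∧ Module.Finite (PolyX n) (orderF n k) ∧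
      (Module.finrank (PolyX n) (orderF n k) : ℤ) = hilbertFn n k := by
  obtain ⟨T, hT, hcard⟩ := card_multiIndex_le n k
  have hli : LinearIndependent (PolyX n) (fun β : T => delPow (β : Fin n → ℕ)) :=
    linearIndependent_delPow.comp _ Subtype.val_injective
  rw [orderF_eq_span hT]
  refine ⟨Module.Free.of_basis (Module.Basis.span hli),
    Module.Finite.of_basis (Module.Basis.span hli), ?_⟩
  rw [finrank_span_eq_card hli, Fintype.card_coe, hcard]

/-- `F_k(D^r[𝐧])` as a product. -/
def freeFEquiv {r : ℕ} (shift : Fin r → ℤ) (k : ℤ) :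
    freeF n shift k ≃ₗ[PolyX n] (∀ i, orderF n (k - shift i)) where
  toFun v i := ⟨(v : Fin r → Weyl n) i, v.2 i (Set.mem_univ i)⟩
  invFun v := ⟨fun i => v i, fun i _ => (v i).2⟩
  map_add' _ _ := rfl
  map_smul' _ _ := rfl
  left_inv _ := rfl
  right_inv _ := rfl

theorem finite_freeF {r : ℕ} (shift : Fin r → ℤ) (k : ℤ) :
    Module.Finite (PolyX n) (freeF n shift k) := by
  have := fun k => (free_finite_finrank_orderF n k).2.1
  exact Module.Finite.equiv (freeFEquiv shift k).symm

theorem finrank_freeF {r : ℕ} (shift : Fin r → ℤ) (k : ℤ) :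
    (Module.finrank (PolyX n) (freeF n shift k) : ℤ) = ∑ i, hilbertFn n (k - shift i) := by
  have h1 := fun k => (free_finite_finrank_orderF n k).1
  have h2 := fun k => (free_finite_finrank_orderF n k).2.1
  rw [(freeFEquiv shift k).finrank_eq, Module.finrank_pi_fintype]
  push_cast
  exact Finset.sum_congr rfl fun i _ => (free_finite_finrank_orderF n _).2.2

end WeylRank

/-! ### The Euler characteristic of a filtered free resolution -/

theorem finrank_eq_of_surjective_add_ker {R A B : Type*} [CommRing R] [IsDomain R] [AddCommGroup A]
    [Module R A] [AddCommGroup B] [Module R B] [Module.Finite R A] (f : A →ₗ[R] B)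
    (hf : Function.Surjective f) :
    Module.finrank R A = Module.finrank R B + Module.finrank R (LinearMap.ker f) := by
  rw [← (LinearMap.ker f).finrank_quotient_add_finrank, (f.quotKerEquivOfSurjective hf).finrank_eq]

/-- The quotient Q/P is torsion, so it has rank 0, and the rank is additive over a domain. -/
theorem finrank_span_eq_of_torsion {R G : Type*} [CommRing R] [IsDomain R] [AddCommGroup G]
    [Module R G] {P Q : Submodule R G} (hPQ : P ≤ Q) [Module.Finite R Q]
    (h : ∀ v ∈ Q, ∃ c : R, c ≠ 0 ∧ c • v ∈ P) : Module.finrank R P = Module.finrank R Q := by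
  have h1 := (P.submoduleOf Q).finrank_quotient_add_finrank
  have h2 : Module.finrank R (Q ⧸ P.submoduleOf Q) = 0 := by
    have : Module.rank R (Q ⧸ P.submoduleOf Q) = 0 := by
      rw [rank_eq_zero_iff]
      intro x
      obtain ⟨⟨v, hv⟩, rfl⟩ := Submodule.mkQ_surjective _ x
      obtain ⟨c, hc, hcv⟩ := h v hv
      refine ⟨c, hc, ?_⟩
      rw [← map_smul]
      exact (Submodule.Quotient.mk_eq_zero _).2 hcv
    rw [Module.finrank, this, map_zero]
  rw [h2, zero_add, (Submodule.submoduleOfEquivOfLe hPQ).finrank_eq] at h1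
  exact h1

/-- The partial alternating sums telescope up to ± the rank of the next image, which vanishes once
the next term has rank 0. -/
theorem finrank_eq_alternating_sum {R A : Type*} [CommRing R] [IsDomain R] [AddCommGroup A]
    [Module R A] {C : ℕ → Type*} [∀ i, AddCommGroup (C i)] [∀ i, Module R (C i)]
    [∀ i, Module.Finite R (C i)] (a : C 0 →ₗ[R] A) (f : ∀ i, C (i + 1) →ₗ[R] C i)
    (ha : Function.Surjective a) (h0 : LinearMap.range (f 0) = LinearMap.ker a)
    (hf : ∀ i, LinearMap.range (f (i + 1)) = LinearMap.ker (f i)) {l : ℕ}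
    (hl : Module.finrank R (C (l + 1)) = 0) :
    (Module.finrank R A : ℤ) =
      ∑ i ∈ Finset.range (l + 1), (-1) ^ i * (Module.finrank R (C i) : ℤ) := by
  have hstep : ∀ i, Module.finrank R (C (i + 1)) =
      Module.finrank R (LinearMap.range (f i)) + Module.finrank R (LinearMap.range (f (i + 1))) := by
    intro i
    rw [hf, finrank_eq_of_surjective_add_ker (f i).rangeRestrict (f i).surjective_rangeRestrict,
      LinearMap.ker_rangeRestrict]
  have key : ∀ m, ∑ i ∈ Finset.range (m + 1), (-1) ^ i * (Module.finrank R (C i) : ℤ) =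
      Module.finrank R A + (-1) ^ m * (Module.finrank R (LinearMap.range (f m)) : ℤ) := by
    intro m
    induction m with
    | zero =>
      rw [Finset.sum_range_one, finrank_eq_of_surjective_add_ker a ha, h0]
      push_cast
      ring
    | succ m ih =>
      rw [Finset.sum_range_succ, ih, hstep]
      push_cast
      ring
  have hz : Module.finrank R (LinearMap.range (f l)) = 0 := by
    have := hstep l
    omega
  rw [key, hz]
  simp

instance weyl_isScalarTower (n : ℕ) : IsScalarTower (PolyX n) (Weyl n) (Weyl n) :=
  ⟨fun p P Q => mul_assoc (polyToWeyl n p) P Q⟩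

namespace FFiltration.FreeResolution

variable {n : ℕ} {M : Type*} [AddCommGroup M] [Module (Weyl n) M] [Module (PolyX n) M]
  [IsScalarTower (PolyX n) (Weyl n) M] {F : FFiltration n M} (L : F.FreeResolution)

theorem aug_mem (k : ℤ) {v : Fin (L.rank 0) → Weyl n} (hv : v ∈ freeF n (L.shift 0) k) :
    L.aug v ∈ F.toFun k := by
  have : L.aug v ∈ (F.toFun k : Set M) := by
    rw [← L.aug_image]; exact ⟨v, hv, rfl⟩
  exact this

theorem diff_mem (i : ℕ) (k : ℤ) {v : Fin (L.rank (i + 1)) → Weyl n}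
    (hv : v ∈ freeF n (L.shift (i + 1)) k) : L.diff i v ∈ freeF n (L.shift i) k := by
  cases i with
  | zero =>
    have : L.diff 0 v ∈ {v | v ∈ freeF n (L.shift 0) k ∧ L.aug v = 0} := by
      rw [← L.exact_zero]; exact ⟨v, hv, rfl⟩
    exact this.1
  | succ i =>
    have : L.diff (i + 1) v ∈ {v | v ∈ freeF n (L.shift (i + 1)) k ∧ L.diff i v = 0} := by
      rw [← L.exact_succ]; exact ⟨v, hv, rfl⟩
    exact this.1

/-- The augmentation on the pieces `F_k`. -/
def augPiece (k : ℤ) : freeF n (L.shift 0) k →ₗ[PolyX n] F.toFun k :=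
  (L.aug.restrictScalars (PolyX n)).restrict fun _ hv => L.aug_mem k hv

/-- The differentials on the pieces `F_k`. -/
def diffPiece (k : ℤ) (i : ℕ) :
    freeF n (L.shift (i + 1)) k →ₗ[PolyX n] freeF n (L.shift i) k :=
  ((L.diff i).restrictScalars (PolyX n)).restrict fun _ hv => L.diff_mem i k hv

theorem augPiece_surjective (k : ℤ) : Function.Surjective (L.augPiece k) := by
  rintro ⟨w, hw⟩
  have : w ∈ (F.toFun k : Set M) := hw
  rw [← L.aug_image] at this
  obtain ⟨v, hv, rfl⟩ := this
  exact ⟨⟨v, hv⟩, rfl⟩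

theorem finite_piece (L : F.FreeResolution) (k : ℤ) : Module.Finite (PolyX n) (F.toFun k) := by
  have := finite_freeF (n := n) (L.shift 0) k
  exact Module.Finite.of_surjective _ (L.augPiece_surjective k)

theorem range_diffPiece_zero (k : ℤ) :
    LinearMap.range (L.diffPiece k 0) = LinearMap.ker (L.augPiece k) := by
  ext ⟨v, hv⟩
  rw [LinearMap.mem_ker, LinearMap.mem_range]
  have h := Set.ext_iff.1 (L.exact_zero k) v
  constructor
  · rintro ⟨w, hw⟩
    have hw' : L.diff 0 w = v := congrArg Subtype.val hw
    exact Subtype.ext (h.1 ⟨w, w.2, hw'⟩).2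
  · intro h0
    obtain ⟨w, hw, hwv⟩ := h.2 ⟨hv, congrArg Subtype.val h0⟩
    exact ⟨⟨w, hw⟩, Subtype.ext hwv⟩

theorem range_diffPiece_succ (k : ℤ) (i : ℕ) :
    LinearMap.range (L.diffPiece k (i + 1)) = LinearMap.ker (L.diffPiece k i) := by
  ext ⟨v, hv⟩
  rw [LinearMap.mem_ker, LinearMap.mem_range]
  have h := Set.ext_iff.1 (L.exact_succ i k) v
  constructor
  · rintro ⟨w, hw⟩
    have hw' : L.diff (i + 1) w = v := congrArg Subtype.val hw
    exact Subtype.ext (h.1 ⟨w, w.2, hw'⟩).2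
  · intro h0
    obtain ⟨w, hw, hwv⟩ := h.2 ⟨hv, congrArg Subtype.val h0⟩
    exact ⟨⟨w, hw⟩, Subtype.ext hwv⟩

/-- The ranks of the pieces of the filtration are determined by the `K`-polynomial. -/
theorem finrank_piece (k : ℤ) :
    (Module.finrank (PolyX n) (F.toFun k) : ℤ) = convolve L.kPolynomial (hilbertFn n) k := by
  have := fun i => finite_freeF (n := n) (L.shift i) k
  rw [finrank_eq_alternating_sum (C := fun i => freeF n (L.shift i) k) (L.augPiece k)
    (L.diffPiece k) (L.augPiece_surjective k) (L.range_diffPiece_zero k) (L.range_diffPiece_succ k)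
    (l := L.length)]
  · unfold kPolynomial
    rw [map_sum, LinearMap.sum_apply, Finset.sum_apply]
    refine Finset.sum_congr rfl fun i _ => ?_
    rw [finrank_freeF, map_mul, map_pow, map_neg, map_one, Module.End.mul_apply, map_sum,
      LinearMap.sum_apply]
    have hneg : ∀ (e : ℕ) (h : ℤ → ℤ), ((-1 : Module.End ℤ (ℤ → ℤ)) ^ e) h k = (-1) ^ e * h k := by
      intro e h
      rcases Nat.even_or_odd e with he | he
      · rw [he.neg_one_pow, he.neg_one_pow]; simp
      · rw [he.neg_one_pow, he.neg_one_pow]; simp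
    rw [hneg, Finset.sum_apply]
    simp_rw [convolve_T]
  · have h0 := L.rank_eq_zero (L.length + 1) (by omega)
    have h1 := finrank_freeF (n := n) (L.shift (L.length + 1)) k
    have : IsEmpty (Fin (L.rank (L.length + 1))) := by rw [h0]; infer_instance
    rw [Finset.univ_eq_empty, Finset.sum_empty] at h1
    exact_mod_cast h1

/-- The generators of `M` given by the augmentation. -/
def gen (j : Fin (L.rank 0)) : M := L.aug (Pi.single j 1)

theorem piece_eq_span (k : ℤ) : F.toFun k = Submodule.span (PolyX n)
    {v | ∃ (j : Fin (L.rank 0)) (β : Fin n → ℕ), ((∑ i, β i : ℕ) : ℤ) + L.shift 0 j ≤ k ∧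
      v = delPow β • L.gen j} := by
  classical
  have hgen : ∀ (j : Fin (L.rank 0)) (P : Weyl n), L.aug (Pi.single j P) = P • L.gen j := by
    intro j P
    rw [gen, ← map_smul, ← Pi.single_smul, smul_eq_mul, mul_one]
  apply le_antisymm
  · intro w hw
    have : w ∈ (F.toFun k : Set M) := hw
    rw [← L.aug_image] at this
    obtain ⟨v, hv, rfl⟩ := this
    rw [← Finset.univ_sum_single v, map_sum]
    refine Submodule.sum_mem _ fun j _ => ?_
    have hvj : v j ∈ orderF n (k - L.shift 0 j) := hv j (Set.mem_univ j)
    rw [hgen]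
    generalize v j = P at hvj
    unfold orderF at hvj
    induction hvj using Submodule.span_induction with
    | mem z hz =>
      obtain ⟨β, hβ, rfl⟩ := hz
      exact Submodule.subset_span ⟨j, β, by omega, rfl⟩
    | zero => rw [zero_smul]; exact zero_mem _
    | add u v _ _ hu hv => rw [add_smul]; exact add_mem hu hv
    | smul c u _ hu => rw [smul_assoc]; exact Submodule.smul_mem _ _ hu
  · refine Submodule.span_le.2 ?_
    rintro _ ⟨j, β, hβ, rfl⟩
    rw [← hgen]
    refine L.aug_mem k fun i _ => ?_
    by_cases hij : i = j
    · subst hij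
      rw [Pi.single_eq_same]
      exact Submodule.subset_span ⟨β, by omega, rfl⟩
    · rw [Pi.single_eq_of_ne hij]; exact zero_mem _

end FFiltration.FreeResolution


namespace FFiltration

variable {n : ℕ} {M : Type*} [AddCommGroup M] [Module (Weyl n) M] [Module (PolyX n) M]
  [IsScalarTower (PolyX n) (Weyl n) M] (F : FFiltration n M)

/-! ### The structure of the associated graded module -/

instance gr_isScalarTower : IsScalarTower (PolyX n) (GrD n) F.Gr :=
  ⟨fun p f g => by rw [MvPolynomial.smul_eq_C_mul, mul_smul, C_smul]⟩

open Classical in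
/-- The class in `gr^F_d(M)` of `v ∈ F_d(M)`, as an element of `gr^F(M)`. -/
def symbol (d : ℤ) (v : M) : F.Gr :=
  if h : v ∈ F.toFun d then F.incl d (F.toGrPiece d ⟨v, h⟩) else 0

variable {F}

theorem symbol_of_mem {d : ℤ} {v : M} (h : v ∈ F.toFun d) :
    F.symbol d v = F.incl d (F.toGrPiece d ⟨v, h⟩) := dif_pos h

theorem X_smul_symbol (i : Fin n) {d : ℤ} {v : M} (h : v ∈ F.toFun d) :
    (MvPolynomial.X i : GrD n) • F.symbol d v = F.symbol (d + 1) (del i • v) := by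
  rw [symbol_of_mem h, symbol_of_mem (F.del_smul_mem i h), X_smul, xi_incl, xiPiece_toGrPiece]

/-- Membership is carried along with the identity because `symbol` takes the default value 0 outside
the filtration piece. -/
theorem X_pow_smul_symbol (i : Fin n) (e : ℕ) {d : ℤ} {v : M} (h : v ∈ F.toFun d) :
    del i ^ e • v ∈ F.toFun (d + e) ∧
      (MvPolynomial.X i ^ e : GrD n) • F.symbol d v = F.symbol (d + e) (del i ^ e • v) := by
  induction e with
  | zero => simpa using h
  | succ e ih =>
    have hd : d + ((e + 1 : ℕ) : ℤ) = d + e + 1 := by push_cast; ring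
    rw [hd, pow_succ', pow_succ', mul_smul, mul_smul, ih.2, X_smul_symbol i ih.1]
    exact ⟨F.del_smul_mem i ih.1, rfl⟩

theorem list_prod_smul_symbol (β : Fin n → ℕ) (l : List (Fin n)) {d : ℤ} {v : M}
    (h : v ∈ F.toFun d) :
    (l.map fun i => del i ^ β i).prod • v ∈ F.toFun (d + ((l.map β).sum : ℕ)) ∧
      (l.map fun i => (MvPolynomial.X i ^ β i : GrD n)).prod • F.symbol d v =
        F.symbol (d + ((l.map β).sum : ℕ)) ((l.map fun i => del i ^ β i).prod • v) := by
  induction l with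
  | nil => simpa using h
  | cons i l ih =>
    have hd : d + (((i :: l).map β).sum : ℕ) = d + ((l.map β).sum : ℕ) + β i := by
      rw [List.map_cons, List.sum_cons]; push_cast; ring
    have h' := X_pow_smul_symbol i (β i) ih.1
    rw [hd, List.map_cons, List.prod_cons, List.map_cons, List.prod_cons, mul_smul, mul_smul, ih.2]
    exact h'

theorem monomial_smul_symbol (β : Fin n →₀ ℕ) {d : ℤ} {v : M} (h : v ∈ F.toFun d) :
    delPow β • v ∈ F.toFun (d + β.degree) ∧
      (MvPolynomial.monomial β 1 : GrD n) • F.symbol d v =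
        F.symbol (d + β.degree) (delPow β • v) := by
  have h' := list_prod_smul_symbol β (List.finRange n) h
  have h1 : ((List.finRange n).map β).sum = β.degree := by
    rw [← List.ofFn_eq_map, List.sum_ofFn, Finsupp.degree_eq_sum]
  have h2 : (MvPolynomial.monomial β 1 : GrD n) =
      ((List.finRange n).map fun i => (MvPolynomial.X i ^ β i : GrD n)).prod := by
    rw [← List.ofFn_eq_map, List.prod_ofFn, MvPolynomial.monomial_eq, Finsupp.prod_fintype _ _
      (by simp), map_one, one_mul]
  rw [h1, ← h2, ← delPow_eq] at h'
  exact h'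

variable (F)

/-- The projection `gr^F(M) → gr^F_d(M)`. -/
def comp (d : ℤ) : F.Gr →ₗ[PolyX n] F.GrPiece d := DirectSum.component (PolyX n) ℤ F.GrPiece d

theorem comp_incl_self (d : ℤ) (x : F.GrPiece d) : F.comp d (F.incl d x) = x :=
  DirectSum.component.lof_self _ _ _

theorem comp_incl_of_ne {d d' : ℤ} (h : d ≠ d') (x : F.GrPiece d) : F.comp d' (F.incl d x) = 0 := by
  exact DirectSum.of_eq_of_ne (β := F.GrPiece) d d' x h.symm

/-- `⨁_{j ≤ k} gr^F_j(M)`. -/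
def upTo (k : ℤ) : Submodule (PolyX n) F.Gr := ⨅ (j : ℤ) (_ : k < j), LinearMap.ker (F.comp j)

theorem mem_upTo {k : ℤ} {g : F.Gr} : g ∈ F.upTo k ↔ ∀ j, k < j → F.comp j g = 0 := by
  simp [upTo]

theorem upTo_mono : Monotone F.upTo := fun _ _ h _ hg =>
  F.mem_upTo.2 fun j hj => F.mem_upTo.1 hg j (lt_of_le_of_lt h hj)

theorem incl_mem_upTo {d k : ℤ} (h : d ≤ k) (x : F.GrPiece d) : F.incl d x ∈ F.upTo k :=
  F.mem_upTo.2 fun j hj => F.comp_incl_of_ne (by omega) x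

theorem gr_eq_sum (g : F.Gr) : ∃ s : Finset ℤ, g = ∑ d ∈ s, F.incl d (F.comp d g) := by
  classical
  refine ⟨DFinsupp.support (β := F.GrPiece) g, ?_⟩
  exact (DirectSum.sum_support_of (β := F.GrPiece) g).symm

theorem exists_mem_upTo (g : F.Gr) : ∃ k, g ∈ F.upTo k := by
  obtain ⟨s, hs⟩ := F.gr_eq_sum g
  obtain ⟨k, hk⟩ := s.exists_le
  refine ⟨k, ?_⟩
  rw [hs]
  exact Submodule.sum_mem _ fun d hd => F.incl_mem_upTo (hk d hd) _

theorem finrank_piece_step (k : ℤ) [Module.Finite (PolyX n) (F.toFun k)] :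
    Module.finrank (PolyX n) (F.toFun k) =
      Module.finrank (PolyX n) (F.GrPiece k) + Module.finrank (PolyX n) (F.toFun (k - 1)) := by
  rw [finrank_eq_of_surjective_add_ker (F.toGrPiece k) (F.toGrPiece_surjective k)]
  congr 1
  have hker : LinearMap.ker (F.toGrPiece k) = (F.toFun (k - 1)).submoduleOf (F.toFun k) :=
    Submodule.ker_mkQ _
  rw [hker, (Submodule.submoduleOfEquivOfLe (F.mono (by omega : k - 1 ≤ k))).finrank_eq]

/-- Same recursion as for the pieces of M: both filtrations have gr_k as successive quotient. -/
theorem finrank_upTo_step (k : ℤ) [Module.Finite (PolyX n) (F.upTo k)] :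
    Module.finrank (PolyX n) (F.upTo k) =
      Module.finrank (PolyX n) (F.GrPiece k) + Module.finrank (PolyX n) (F.upTo (k - 1)) := by
  have hle : F.upTo (k - 1) ≤ F.upTo k := F.upTo_mono (by omega)
  rw [finrank_eq_of_surjective_add_ker ((F.comp k).domRestrict (F.upTo k))
    (fun x => ⟨⟨F.incl k x, F.incl_mem_upTo le_rfl x⟩, F.comp_incl_self k x⟩)]
  congr 1
  have hker : LinearMap.ker ((F.comp k).domRestrict (F.upTo k)) =
      (F.upTo (k - 1)).submoduleOf (F.upTo k) := by
    ext ⟨g, hg⟩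
    change F.comp k g = 0 ↔ g ∈ F.upTo (k - 1)
    rw [mem_upTo] at hg ⊢
    refine ⟨fun h j hj => ?_, fun h => h k (by omega)⟩
    rcases eq_or_ne j k with rfl | hne
    · exact h
    · exact hg j (by omega)
  rw [hker, (Submodule.submoduleOfEquivOfLe hle).finrank_eq]

end FFiltration

/-! ### Monomial generators of the associated graded module -/

namespace FFiltration.FreeResolution

variable {n : ℕ} {M : Type*} [AddCommGroup M] [Module (Weyl n) M] [Module (PolyX n) M]
  [IsScalarTower (PolyX n) (Weyl n) M] {F : FFiltration n M} (L : F.FreeResolution)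

/-- The symbols of the generators. -/
def genSymbol (j : Fin (L.rank 0)) : F.Gr := F.symbol (L.shift 0 j) (L.gen j)

/-- The elements `ξ^β · g_j` of `gr^F(M)`, where the `g_j` are the symbols of the generators. -/
def mon (b : Fin (L.rank 0) × (Fin n →₀ ℕ)) : F.Gr :=
  (MvPolynomial.monomial b.2 1 : GrD n) • L.genSymbol b.1

/-- The degree of `ξ^β · g_j`. -/
def deg (b : Fin (L.rank 0) × (Fin n →₀ ℕ)) : ℤ := L.shift 0 b.1 + b.2.degree

theorem gen_mem (j : Fin (L.rank 0)) : L.gen j ∈ F.toFun (L.shift 0 j) := by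
  rw [L.piece_eq_span]
  refine Submodule.subset_span ⟨j, 0, by simp, ?_⟩
  simp [delPow_eq]

theorem mon_eq_symbol (b : Fin (L.rank 0) × (Fin n →₀ ℕ)) :
    delPow b.2 • L.gen b.1 ∈ F.toFun (L.deg b) ∧
      L.mon b = F.symbol (L.deg b) (delPow b.2 • L.gen b.1) :=
  monomial_smul_symbol b.2 (L.gen_mem b.1)

theorem exists_mon_eq_incl (b : Fin (L.rank 0) × (Fin n →₀ ℕ)) :
    ∃ x : F.GrPiece (L.deg b), L.mon b = F.incl (L.deg b) x := by
  obtain ⟨h, h'⟩ := L.mon_eq_symbol b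
  exact ⟨_, h'.trans (symbol_of_mem h)⟩

/-- Among the generators ∂^β g_j of F_k(M), those of degree below k die in gr_k, and the remaining
ones have symbol ξ^β g_j. -/
theorem incl_mem_span (k : ℤ) (x : F.GrPiece k) :
    F.incl k x ∈ Submodule.span (PolyX n) (L.mon '' {b | L.deg b = k}) := by
  obtain ⟨⟨v, hv⟩, rfl⟩ := F.toGrPiece_surjective k x
  have hle := le_of_eq (L.piece_eq_span k).symm
  have h := hv
  rw [L.piece_eq_span] at h
  induction h using Submodule.span_induction with
  | mem z hz =>
    obtain ⟨j, β, hβ, rfl⟩ := hz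
    obtain ⟨hm, he⟩ := L.mon_eq_symbol (j, Finsupp.equivFunOnFinite.symm β)
    have hdeg : L.deg (j, Finsupp.equivFunOnFinite.symm β) = (∑ i, β i : ℕ) + L.shift 0 j := by
      rw [deg, Finsupp.degree_eq_sum]
      simp [add_comm]
    rcases hβ.lt_or_eq with hlt | heq
    · rw [(F.toGrPiece_eq_zero _).2, map_zero]
      · exact zero_mem _
      · exact F.mono (by rw [hdeg]; omega) hm
    · rw [heq] at hdeg
      refine Submodule.subset_span ⟨_, hdeg, ?_⟩
      rw [he, hdeg]
      exact symbol_of_mem hv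
  | zero =>
    have : (⟨0, hv⟩ : F.toFun k) = 0 := rfl
    rw [this, map_zero, map_zero]; exact zero_mem _
  | add u w hu hw ihu ihw =>
    have : F.incl k (F.toGrPiece k ⟨u + w, hv⟩) = F.incl k (F.toGrPiece k ⟨u, hle hu⟩) +
      F.incl k (F.toGrPiece k ⟨w, hle hw⟩) := by rw [← map_add, ← map_add]; rfl
    rw [this]
    exact add_mem (ihu _) (ihw _)
  | smul c u hu ihu =>
    have : F.incl k (F.toGrPiece k ⟨c • u, hv⟩) =
        c • F.incl k (F.toGrPiece k ⟨u, hle hu⟩) := by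
      rw [← map_smul, ← map_smul]; rfl
    rw [this]
    exact Submodule.smul_mem _ _ (ihu _)

theorem upTo_eq_span (k : ℤ) :
    F.upTo k = Submodule.span (PolyX n) (L.mon '' {b | L.deg b ≤ k}) := by
  apply le_antisymm
  · intro g hg
    obtain ⟨s, hs⟩ := F.gr_eq_sum g
    rw [hs]
    refine Submodule.sum_mem _ fun d _ => ?_
    rcases le_or_gt d k with hd | hd
    · exact Submodule.span_mono (Set.image_mono fun b hb => (le_of_eq_of_le hb hd : L.deg b ≤ k))
        (L.incl_mem_span d _)
    · rw [F.mem_upTo.1 hg d hd, map_zero]; exact zero_mem _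
  · refine Submodule.span_le.2 ?_
    rintro _ ⟨b, hb, rfl⟩
    obtain ⟨x, hx⟩ := L.exists_mon_eq_incl b
    rw [hx]
    exact F.incl_mem_upTo hb x

theorem span_mon : Submodule.span (PolyX n) (Set.range L.mon) = ⊤ := by
  refine eq_top_iff.2 fun g _ => ?_
  obtain ⟨k, hk⟩ := F.exists_mem_upTo g
  rw [L.upTo_eq_span] at hk
  exact Submodule.span_mono (Set.image_subset_range _ _) hk

theorem span_genSymbol : Submodule.span (GrD n) (Set.range L.genSymbol) = ⊤ := by
  refine eq_top_iff.2 fun g _ => ?_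
  have hg : g ∈ Submodule.span (PolyX n) (Set.range L.mon) := L.span_mon ▸ trivial
  have hle : Submodule.span (PolyX n) (Set.range L.mon) ≤
      (Submodule.span (GrD n) (Set.range L.genSymbol)).restrictScalars (PolyX n) := by
    refine Submodule.span_le.2 ?_
    rintro _ ⟨b, rfl⟩
    exact Submodule.smul_mem (Submodule.span (GrD n) (Set.range L.genSymbol)) _
      (Submodule.subset_span (Set.mem_range_self b.1))
  exact hle hg

theorem finite_gr (L : F.FreeResolution) : Module.Finite (GrD n) F.Gr :=
  ⟨L.span_genSymbol ▸ Submodule.fg_span (Set.finite_range L.genSymbol)⟩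

theorem exists_le_shift : ∃ k₀ : ℤ, ∀ j, k₀ ≤ L.shift 0 j := by
  obtain ⟨k₀, h⟩ := (Set.finite_range (L.shift 0)).bddBelow
  exact ⟨k₀, fun j => h ⟨j, rfl⟩⟩

theorem finite_deg_le (k : ℤ) : {b | L.deg b ≤ k}.Finite := by
  obtain ⟨k₀, h₀⟩ := L.exists_le_shift
  refine (Set.finite_univ.prod (Finsupp.finite_of_degree_le (σ := Fin n) (k - k₀).toNat)).subset ?_
  rintro ⟨j, β⟩ hb
  refine ⟨trivial, ?_⟩
  have h1 : L.shift 0 j + (β.degree : ℤ) ≤ k := hb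
  have h2 := h₀ j
  change β.degree ≤ _
  omega

theorem finite_upTo (L : F.FreeResolution) (k : ℤ) : Module.Finite (PolyX n) (F.upTo k) := by
  rw [L.upTo_eq_span]
  exact Module.Finite.span_of_finite _ ((L.finite_deg_le k).image _)

/-- Both ranks vanish below the least shift and satisfy the same recursion above it. -/
theorem finrank_upTo (L : F.FreeResolution) (k : ℤ) :
    Module.finrank (PolyX n) (F.upTo k) = Module.finrank (PolyX n) (F.toFun k) := by
  obtain ⟨k₀, h₀⟩ := L.exists_le_shift
  have hlow : ∀ k < k₀,
      Module.finrank (PolyX n) (F.upTo k) = Module.finrank (PolyX n) (F.toFun k) := by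
    intro k hk
    have h1 : F.upTo k = ⊥ := by
      rw [L.upTo_eq_span, Submodule.span_eq_bot]
      rintro _ ⟨b, hb, rfl⟩
      have h1 : L.shift 0 b.1 + (b.2.degree : ℤ) ≤ k := hb
      have h2 := h₀ b.1
      omega
    have h2 : F.toFun k = ⊥ := by
      rw [L.piece_eq_span, Submodule.span_eq_bot]
      rintro _ ⟨j, β, hβ, rfl⟩
      have h2 := h₀ j
      omega
    rw [h1, h2, finrank_bot, finrank_bot]
  rcases lt_or_ge k k₀ with hk | hk
  · exact hlow k hk
  · induction k, hk using Int.leInduction with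
    | base =>
      have := L.finite_piece k₀
      have := L.finite_upTo k₀
      rw [F.finrank_upTo_step, F.finrank_piece_step, hlow (k₀ - 1) (by omega)]
    | succ k hk ih =>
      have := L.finite_piece (k + 1)
      have := L.finite_upTo (k + 1)
      rw [F.finrank_upTo_step, F.finrank_piece_step, add_sub_cancel_right, ih]

/-- Standard monomials of the associated graded module. -/
theorem exists_standard_mon :
    ∃ (Std : Set (Fin (L.rank 0) × (Fin n →₀ ℕ))) (q : PolyX n), q ≠ 0 ∧
      LinearIndependent (PolyX n) (fun b : Std => L.mon b) ∧
      ∀ k, ∀ v ∈ F.upTo k, ∃ N : ℕ,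
        q ^ N • v ∈ Submodule.span (PolyX n) (L.mon '' {b | b ∈ Std ∧ L.deg b ≤ k}) := by
  obtain ⟨k₀, h₀⟩ := L.exists_le_shift
  -- Weights must be natural numbers; measured from the lower bound k₀, the shifts lose nothing
  -- under `toNat`.
  obtain ⟨Std, q, hq, hli, hspan⟩ := exists_standard L.mon
    (fun γ => F.grAction (MvPolynomial.monomial γ 1)) (fun γ j β => by
      change (MvPolynomial.monomial γ 1 : GrD n) • (MvPolynomial.monomial β 1 : GrD n) •
        L.genSymbol j = _
      rw [smul_smul, MvPolynomial.monomial_mul, one_mul]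
      rfl) (fun j => (L.shift 0 j - k₀).toNat)
  refine ⟨Std, q, hq, hli, fun k v hv => ?_⟩
  rw [L.upTo_eq_span] at hv
  refine exists_pow_smul_mem_of_mem_span L.mon (fun b hb => ?_) hv
  obtain ⟨N, hN⟩ := hspan b
  refine ⟨N, Submodule.span_mono (Set.image_mono fun b' hb' => (⟨hb'.1, ?_⟩ : _ ∧ _)) hN⟩
  have h1 := hb'.2
  have h2 : L.shift 0 b.1 + (b.2.degree : ℤ) ≤ k := hb
  have h3 := h₀ b.1
  have h4 := h₀ b'.1
  change L.shift 0 b'.1 + (b'.2.degree : ℤ) ≤ k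
  omega

/-- Standard monomials of degree at most k are independent and span that part of gr(M) up to torsion
by powers of q, so their number is its rank. -/
theorem card_standard {Std : Set (Fin (L.rank 0) × (Fin n →₀ ℕ))} {q : PolyX n} (hq : q ≠ 0)
    (hli : LinearIndependent (PolyX n) (fun b : Std => L.mon b))
    (hspan : ∀ k, ∀ v ∈ F.upTo k, ∃ N : ℕ,
        q ^ N • v ∈ Submodule.span (PolyX n) (L.mon '' {b | b ∈ Std ∧ L.deg b ≤ k})) (k : ℤ) :
    Nat.card {b // b ∈ Std ∧ L.deg b ≤ k} = Module.finrank (PolyX n) (F.toFun k) := by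
  have hfin : Finite {b // b ∈ Std ∧ L.deg b ≤ k} :=
    ((L.finite_deg_le k).subset fun b hb => hb.2).to_subtype
  have := Fintype.ofFinite {b // b ∈ Std ∧ L.deg b ≤ k}
  have hli' : LinearIndependent (PolyX n)
      (fun b : {b // b ∈ Std ∧ L.deg b ≤ k} => L.mon b.1) :=
    hli.comp (fun b : {b // b ∈ Std ∧ L.deg b ≤ k} => (⟨b.1, b.2.1⟩ : Std)) fun b b' h =>
      Subtype.ext (congrArg (fun x : Std => x.1) h)
  have := L.finite_upTo k
  rw [← L.finrank_upTo, Nat.card_eq_fintype_card, ← finrank_span_eq_card hli']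
  have hrange : Set.range (fun b : {b // b ∈ Std ∧ L.deg b ≤ k} => L.mon b.1) =
      L.mon '' {b | b ∈ Std ∧ L.deg b ≤ k} := (Set.image_eq_range _ _).symm
  rw [hrange]
  refine finrank_span_eq_of_torsion ?_ fun v hv => ?_
  · rw [L.upTo_eq_span]
    exact Submodule.span_mono (Set.image_mono fun b hb => hb.2)
  · obtain ⟨N, hN⟩ := hspan k v hv
    exact ⟨q ^ N, pow_ne_zero _ hq, hN⟩

end FFiltration.FreeResolution


/-! ### The fibers of the associated graded module -/

namespace FFiltration

variable {n : ℕ} {M : Type*} [AddCommGroup M] [Module (Weyl n) M] [Module (PolyX n) M]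
  [IsScalarTower (PolyX n) (Weyl n) M] (F : FFiltration n M) (x₀ : Fin n → ℂ)

/-- Modulo the ideal, x_i and (x₀)_i agree, so two ring homomorphisms coincide on generators. -/
theorem sub_map_eval_mem_pointIdeal (f : GrD n) :
    f - MvPolynomial.map MvPolynomial.C (MvPolynomial.map (MvPolynomial.eval x₀) f) ∈
      pointIdeal x₀ := by
  rw [← Ideal.Quotient.eq_zero_iff_mem, map_sub, sub_eq_zero]
  have h : (Ideal.Quotient.mk (pointIdeal x₀)) =
      (Ideal.Quotient.mk (pointIdeal x₀)).comp
        ((MvPolynomial.map MvPolynomial.C).comp (MvPolynomial.map (MvPolynomial.eval x₀))) := by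
    refine MvPolynomial.ringHom_ext' (MvPolynomial.ringHom_ext (fun c => by simp) fun i => ?_)
      fun i => by simp
    simp only [RingHom.comp_apply, MvPolynomial.map_C, MvPolynomial.eval_X]
    rw [← sub_eq_zero, ← map_sub, Ideal.Quotient.eq_zero_iff_mem, ← map_sub]
    exact Ideal.subset_span ⟨i, rfl⟩
  exact RingHom.congr_fun h f

theorem mem_pointIdeal_smul {f : GrD n} (hf : f ∈ pointIdeal x₀) (v : F.Fiber x₀) : f • v = 0 := by
  obtain ⟨g, rfl⟩ := Submodule.Quotient.mk_surjective _ v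
  exact (Submodule.Quotient.mk_eq_zero _).2 (Submodule.smul_mem_smul hf trivial)

theorem map_eval_smul (f : GrD n) (v : F.Fiber x₀) :
    (MvPolynomial.map (MvPolynomial.eval x₀) f : PolyXi n) • v = f • v := by
  have h := F.mem_pointIdeal_smul x₀ (sub_map_eval_mem_pointIdeal x₀ f) v
  rw [sub_smul, sub_eq_zero] at h
  exact h.symm

instance fiber_isScalarTower : IsScalarTower ℂ (PolyXi n) (F.Fiber x₀) :=
  ⟨fun c f v => by rw [MvPolynomial.smul_eq_C_mul, mul_smul]; rfl⟩

/-- The projection of `gr^F(M)` onto its fiber. -/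
def toFiber : F.Gr →ₛₗ[MvPolynomial.eval x₀] F.Fiber x₀ where
  toFun g := Submodule.Quotient.mk g
  map_add' _ _ := rfl
  map_smul' p g := by
    have h := F.map_eval_smul x₀ (MvPolynomial.C p) (Submodule.Quotient.mk g : F.Fiber x₀)
    rw [MvPolynomial.map_C] at h
    refine Eq.trans ?_ h.symm
    rw [← C_smul]
    rfl

theorem toFiber_surjective : Function.Surjective (F.toFiber x₀) :=
  Submodule.Quotient.mk_surjective _

theorem toFiber_monomial_smul (β : Fin n →₀ ℕ) (g : F.Gr) :
    F.toFiber x₀ ((MvPolynomial.monomial β 1 : GrD n) • g) =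
      (MvPolynomial.monomial β 1 : PolyXi n) • F.toFiber x₀ g := by
  have h := F.map_eval_smul x₀ (MvPolynomial.monomial β 1) (F.toFiber x₀ g)
  rw [MvPolynomial.map_monomial, map_one] at h
  exact h.symm

/-- The generators of `pointIdeal` do not involve ξ, so the kernel is already generated by the
maximal ideal of ℂ[x] at x₀. This is the form that specialization needs. -/
theorem mem_of_toFiber_eq_zero {g : F.Gr} (hg : F.toFiber x₀ g = 0) :
    g ∈ RingHom.ker (MvPolynomial.eval x₀) • (⊤ : Submodule (PolyX n) F.Gr) := by
  have hg' : g ∈ pointIdeal x₀ • (⊤ : Submodule (GrD n) F.Gr) :=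
    (Submodule.Quotient.mk_eq_zero _).1 hg
  have key : ∀ f ∈ pointIdeal x₀, ∀ g : F.Gr,
      f • g ∈ RingHom.ker (MvPolynomial.eval x₀) • (⊤ : Submodule (PolyX n) F.Gr) := by
    intro f hf
    induction hf using Submodule.span_induction with
    | mem z hz =>
      obtain ⟨i, rfl⟩ := hz
      intro g
      rw [C_smul]
      exact Submodule.smul_mem_smul (by simp) trivial
    | zero => intro g; rw [zero_smul]; exact zero_mem _
    | add a b _ _ ha hb => intro g; rw [add_smul]; exact add_mem (ha g) (hb g)
    | smul c a _ ha => intro g; rw [smul_eq_mul, mul_comm, mul_smul]; exact ha _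
  exact Submodule.smul_induction_on hg' (fun f hf g _ => key f hf g) fun _ _ => add_mem

/-- The fiber of the characteristic variety is the zero locus of the annihilator of the fiber. -/
theorem charFiber_eq_zeroLocus [Module.Finite (GrD n) F.Gr] :
    F.charFiber x₀ = MvPolynomial.zeroLocus ℂ (Module.annihilator (PolyXi n) (F.Fiber x₀)) := by
  have hmem : ∀ ξ, ξ ∈ F.charFiber x₀ ↔ ∀ f ∈ Module.annihilator (GrD n) F.Gr,
      MvPolynomial.eval₂ (MvPolynomial.eval x₀) ξ f = 0 := by
    intro ξ
    constructor
    · rintro ⟨⟨x, ξ'⟩, ⟨h, hx⟩, rfl⟩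
      obtain rfl : x = x₀ := hx
      exact h
    · intro h
      exact ⟨(x₀, ξ), ⟨h, rfl⟩, rfl⟩
  ext ξ
  rw [hmem, MvPolynomial.mem_zeroLocus_iff]
  constructor
  · intro h f hf
    -- The point (x₀, ξ) as a prime ideal: it lies in Supp gr(M) and contains the ideal of the
    -- fiber, hence lies in the support of the quotient, as gr(M) is finite.
    let P : PrimeSpectrum (GrD n) :=
      ⟨RingHom.ker (MvPolynomial.eval₂Hom (MvPolynomial.eval x₀) ξ), RingHom.ker_isPrime _⟩
    have hP : P ∈ Module.support (GrD n)
        (F.Gr ⧸ (pointIdeal x₀ • (⊤ : Submodule (GrD n) F.Gr))) := by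
      rw [Module.support_quotient, Module.support_eq_zeroLocus]
      refine ⟨fun g hg => h g hg, ?_⟩
      refine Ideal.span_le.2 ?_
      rintro _ ⟨i, rfl⟩
      change MvPolynomial.eval₂ (MvPolynomial.eval x₀) ξ _ = 0
      simp
    rw [Module.support_eq_zeroLocus] at hP
    have hf' : (MvPolynomial.map MvPolynomial.C f : GrD n) ∈ Module.annihilator (GrD n)
        (F.Gr ⧸ (pointIdeal x₀ • (⊤ : Submodule (GrD n) F.Gr))) :=
      Module.mem_annihilator.2 fun v => Module.mem_annihilator.1 hf v
    have h0 : MvPolynomial.eval₂ (MvPolynomial.eval x₀) ξ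
      (MvPolynomial.map MvPolynomial.C f : GrD n) = 0 := hP hf'
    rw [MvPolynomial.eval₂_map] at h0
    rw [MvPolynomial.aeval_def, ← h0]
    congr 1
    ext c
    simp
  -- Conversely, an annihilator of gr(M), evaluated at x = x₀, annihilates the fiber.
  · intro h f hf
    have hf' : MvPolynomial.map (MvPolynomial.eval x₀) f ∈
        Module.annihilator (PolyXi n) (F.Fiber x₀) := by
      rw [Module.mem_annihilator]
      intro v
      rw [map_eval_smul]
      obtain ⟨g, rfl⟩ := Submodule.Quotient.mk_surjective _ v
      have : f • g = 0 := Module.mem_annihilator.1 hf g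
      exact (congrArg (Submodule.Quotient.mk : F.Gr → F.Fiber x₀) this)
    have := h _ hf'
    rwa [MvPolynomial.aeval_def, MvPolynomial.eval₂_map] at this

/-- By the Nullstellensatz the vanishing ideal is the radical of the annihilator of the fiber, and
passing to the radical keeps the dimension. -/
theorem setHasCodim_charFiber [Module.Finite (GrD n) F.Gr] [Module.Finite (PolyXi n) (F.Fiber x₀)]
    {d : ℕ} (h : HasCodim n (F.Fiber x₀) d) : SetHasCodim (F.charFiber x₀) d := by
  unfold HasCodim at h
  unfold SetHasCodim
  rw [charFiber_eq_zeroLocus, MvPolynomial.vanishingIdeal_zeroLocus_eq_radical, ringKrullDim_quotient,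
    PrimeSpectrum.zeroLocus_radical, ← ringKrullDim_quotient,
    ← Module.supportDim_eq_ringKrullDim_quotient_annihilator]
  exact h

theorem charFiber_eq_empty [Module.Finite (GrD n) F.Gr] [Subsingleton (F.Fiber x₀)] :
    F.charFiber x₀ = ∅ := by
  rw [charFiber_eq_zeroLocus, Module.annihilator_eq_top_iff.2 ‹_›, MvPolynomial.zeroLocus_top]
  rfl

/-- `⨁_{j ≤ k}` of the homogeneous parts of the fiber. -/
def fiberUpTo (k : ℤ) : Submodule ℂ (F.Fiber x₀) := ⨆ j ≤ k, F.fiberPiece x₀ j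

theorem fiberUpTo_mono : Monotone (F.fiberUpTo x₀) := fun _ _ h =>
  iSup₂_le fun j hj => le_iSup₂_of_le j (hj.trans h) le_rfl

end FFiltration

/-! ### Hilbert functions of the fibers -/

namespace FFiltration.FreeResolution

variable {n : ℕ} {M : Type*} [AddCommGroup M] [Module (Weyl n) M] [Module (PolyX n) M]
  [IsScalarTower (PolyX n) (Weyl n) M] {F : FFiltration n M} (L : F.FreeResolution)
  (x₀ : Fin n → ℂ)

theorem toFiber_mon_mem (b : Fin (L.rank 0) × (Fin n →₀ ℕ)) {k : ℤ} (hb : L.deg b ≤ k) :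
    F.toFiber x₀ (L.mon b) ∈ F.fiberUpTo x₀ k := by
  obtain ⟨x, hx⟩ := L.exists_mon_eq_incl b
  refine Submodule.mem_iSup_of_mem (L.deg b) (Submodule.mem_iSup_of_mem hb ?_)
  rw [hx]
  exact Submodule.subset_span ⟨x, rfl⟩

theorem fiberUpTo_eq_span (k : ℤ) : F.fiberUpTo x₀ k =
    Submodule.span ℂ ((fun b => F.toFiber x₀ (L.mon b)) '' {b | L.deg b ≤ k}) := by
  apply le_antisymm
  · refine iSup₂_le fun j hj => Submodule.span_le.2 ?_
    rintro _ ⟨g, rfl⟩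
    have h := F.incl_mem_upTo hj g
    rw [L.upTo_eq_span] at h
    -- Here the monomials span without denominators, so q = 1 and N = 0.
    have := mem_span_specialization (q := (1 : PolyX n)) (ev := MvPolynomial.eval x₀)
      (π := F.toFiber x₀) (e := L.mon) (N := 0) (by simp) (by rwa [pow_zero, one_smul])
    exact this
  · refine Submodule.span_le.2 ?_
    rintro _ ⟨b, hb, rfl⟩
    exact L.toFiber_mon_mem x₀ b hb

theorem finite_fiberUpTo (L : F.FreeResolution) (k : ℤ) :
    FiniteDimensional ℂ (F.fiberUpTo x₀ k) := by
  rw [L.fiberUpTo_eq_span]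
  exact FiniteDimensional.span_of_finite ℂ ((L.finite_deg_le k).image _)

theorem exists_mem_fiberUpTo (L : F.FreeResolution) (v : F.Fiber x₀) :
    ∃ k : ℕ, v ∈ F.fiberUpTo x₀ k := by
  obtain ⟨g, rfl⟩ := F.toFiber_surjective x₀ v
  obtain ⟨k, hk⟩ := F.exists_mem_upTo g
  have h := F.upTo_mono (Int.self_le_toNat k) hk
  rw [L.upTo_eq_span] at h
  refine ⟨k.toNat, ?_⟩
  rw [L.fiberUpTo_eq_span]
  exact mem_span_specialization (q := (1 : PolyX n)) (ev := MvPolynomial.eval x₀)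
      (π := F.toFiber x₀) (e := L.mon) (N := 0) (by simp) (by rwa [pow_zero, one_smul])

theorem finite_fiber (L : F.FreeResolution) : Module.Finite (PolyXi n) (F.Fiber x₀) := by
  refine ⟨Submodule.fg_def.2 ⟨_, Set.finite_range fun j => F.toFiber x₀ (L.genSymbol j), ?_⟩⟩
  refine eq_top_iff.2 fun v _ => ?_
  obtain ⟨k, hk⟩ := L.exists_mem_fiberUpTo x₀ v
  rw [L.fiberUpTo_eq_span] at hk
  have hle : Submodule.span ℂ ((fun b => F.toFiber x₀ (L.mon b)) '' {b | L.deg b ≤ k}) ≤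
      (Submodule.span (PolyXi n) (Set.range fun j => F.toFiber x₀ (L.genSymbol j))).restrictScalars
        ℂ := by
    refine Submodule.span_le.2 ?_
    rintro _ ⟨b, -, rfl⟩
    change F.toFiber x₀ ((MvPolynomial.monomial b.2 1 : GrD n) • L.genSymbol b.1) ∈
      Submodule.span (PolyXi n) (Set.range fun j => F.toFiber x₀ (L.genSymbol j))
    rw [toFiber_monomial_smul]
    exact Submodule.smul_mem _ _ (Submodule.subset_span ⟨b.1, rfl⟩)
  exact hle hk

theorem X_smul_mem_fiberUpTo (L : F.FreeResolution) (i : Fin n) {k : ℤ} {v : F.Fiber x₀}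
    (hv : v ∈ F.fiberUpTo x₀ k) :
    (MvPolynomial.X i : PolyXi n) • v ∈ F.fiberUpTo x₀ (k + 1) := by
  rw [L.fiberUpTo_eq_span] at hv
  induction hv using Submodule.span_induction with
  | mem z hz =>
    obtain ⟨b, hb, rfl⟩ := hz
    have h1 : (MvPolynomial.X i : PolyXi n) • F.toFiber x₀ (L.mon b) =
        F.toFiber x₀ (L.mon (b.1, Finsupp.single i 1 + b.2)) := by
      rw [mon, mon, toFiber_monomial_smul, toFiber_monomial_smul, smul_smul, MvPolynomial.X,
        MvPolynomial.monomial_mul, one_mul]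
    change (MvPolynomial.X i : PolyXi n) • F.toFiber x₀ (L.mon b) ∈ _
    rw [h1]
    refine L.toFiber_mon_mem x₀ _ ?_
    have hb' : L.shift 0 b.1 + (b.2.degree : ℤ) ≤ k := hb
    simp only [deg, map_add, Finsupp.degree_single]
    push_cast
    omega
  | zero => rw [smul_zero]; exact zero_mem _
  | add u v _ _ hu hv => rw [smul_add]; exact add_mem hu hv
  | smul c u _ hu => rw [smul_comm]; exact Submodule.smul_mem _ _ hu

theorem exists_smul_mem_fiberUpTo (L : F.FreeResolution) (f : PolyXi n) : ∃ E : ℕ, ∀ (k : ℕ),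
    ∀ v ∈ F.fiberUpTo x₀ k, f • v ∈ F.fiberUpTo x₀ ((k + E : ℕ) : ℤ) := by
  induction f using MvPolynomial.induction_on with
  | C c => exact ⟨0, fun k v hv => Submodule.smul_mem _ c hv⟩
  | add f g hf hg =>
    obtain ⟨E, hE⟩ := hf
    obtain ⟨E', hE'⟩ := hg
    refine ⟨max E E', fun k v hv => ?_⟩
    rw [add_smul]
    refine add_mem (F.fiberUpTo_mono x₀ ?_ (hE k v hv)) (F.fiberUpTo_mono x₀ ?_ (hE' k v hv))
    · exact_mod_cast Nat.add_le_add_left (le_max_left _ _) k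
    · exact_mod_cast Nat.add_le_add_left (le_max_right _ _) k
  | mul_X f i hf =>
    obtain ⟨E, hE⟩ := hf
    refine ⟨E + 1, fun k v hv => ?_⟩
    rw [mul_comm, mul_smul]
    have := L.X_smul_mem_fiberUpTo x₀ i (hE k v hv)
    exact_mod_cast this

/-- For generic `x₀` the Hilbert function of the fiber is the rank of the pieces of `M`. -/
theorem exists_finrank_fiberUpTo (L : F.FreeResolution) :
    ∃ q : PolyX n, q ≠ 0 ∧ ∀ x₀, MvPolynomial.eval x₀ q ≠ 0 → ∀ k,
      Module.finrank ℂ (F.fiberUpTo x₀ k) = Module.finrank (PolyX n) (F.toFun k) := by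
  obtain ⟨Std, q, hq, hli, hspan⟩ := L.exists_standard_mon
  refine ⟨q, hq, fun x₀ hx₀ k => ?_⟩
  have hfin : Finite {b // b ∈ Std ∧ L.deg b ≤ k} :=
    ((L.finite_deg_le k).subset fun b hb => hb.2).to_subtype
  have := Fintype.ofFinite {b // b ∈ Std ∧ L.deg b ≤ k}
  -- All standard monomials stay independent at once, so the condition q(x₀) ≠ 0 does not depend on
  -- k.
  have hli' : LinearIndependent ℂ (fun b : Std => F.toFiber x₀ (L.mon b)) := by
    refine linearIndependent_specialization hli (q := q) (fun v => ?_) hx₀ (fun c => ⟨.C c, by simp⟩)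
      fun v hv => F.mem_of_toFiber_eq_zero x₀ hv
    obtain ⟨k, hk⟩ := F.exists_mem_upTo v
    obtain ⟨N, hN⟩ := hspan k v hk
    exact ⟨N, Submodule.span_mono (Set.image_mono fun b hb => hb.1) hN⟩
  have hli'' : LinearIndependent ℂ
      (fun b : {b // b ∈ Std ∧ L.deg b ≤ k} => F.toFiber x₀ (L.mon b.1)) :=
    hli'.comp (fun b : {b // b ∈ Std ∧ L.deg b ≤ k} => (⟨b.1, b.2.1⟩ : Std)) fun b b' h =>
      Subtype.ext (congrArg (fun x : Std => x.1) h)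
  rw [← L.card_standard hq hli hspan, Nat.card_eq_fintype_card, ← finrank_span_eq_card hli'']
  -- Every monomial of degree at most k, times a power of q, is a combination of standard ones of
  -- degree at most k, and q(x₀) can be inverted.
  have heq : F.fiberUpTo x₀ k = Submodule.span ℂ (Set.range
      fun b : {b // b ∈ Std ∧ L.deg b ≤ k} => F.toFiber x₀ (L.mon b.1)) := by
    apply le_antisymm
    · rw [L.fiberUpTo_eq_span, Submodule.span_le]
      rintro _ ⟨b, hb, rfl⟩
      have hb' : L.mon b ∈ F.upTo k := by
        rw [L.upTo_eq_span]; exact Submodule.subset_span ⟨b, hb, rfl⟩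
      obtain ⟨N, hN⟩ := hspan k _ hb'
      have := mem_span_specialization (ev := MvPolynomial.eval x₀) (π := F.toFiber x₀) hx₀ hN
      rw [Set.image_eq_range] at this
      exact this
    · refine Submodule.span_le.2 ?_
      rintro _ ⟨b, rfl⟩
      exact L.toFiber_mon_mem x₀ b.1 b.2.2
  rw [heq]

end FFiltration.FreeResolution


/-! ### Comparison of growth rates -/

/-- If s < p, the quotient is at most C 2^s / k and tends to 0, against a ≠ 0. -/
theorem le_of_tendsto_of_growth_le {h : ℕ → ℕ} {p s C : ℕ} {a : ℝ} (ha : a ≠ 0)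
    (hlim : Filter.Tendsto (fun k : ℕ => (h k : ℝ) / (k : ℝ) ^ p) Filter.atTop (nhds a))
    (hup : ∀ k, h k ≤ C * (k + 1) ^ s) : p ≤ s := by
  by_contra! hsp
  apply ha
  refine tendsto_nhds_unique hlim ?_
  have hC := tendsto_const_div_atTop_nhds_zero_nat ((C : ℝ) * 2 ^ s)
  refine squeeze_zero' (Filter.Eventually.of_forall fun k => by positivity) ?_ hC
  filter_upwards [Filter.eventually_ge_atTop 1] with k hk
  have hk' : (1 : ℝ) ≤ k := by exact_mod_cast hk
  have h1 : (h k : ℝ) ≤ C * ((k : ℝ) + 1) ^ s := by exact_mod_cast hup k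
  have h2 : ((k : ℝ) + 1) ^ s ≤ (2 * k) ^ s := by gcongr; linarith
  have h3 : (k : ℝ) ^ (s + 1) ≤ (k : ℝ) ^ p := pow_le_pow_right₀ hk' hsp
  rw [div_le_div_iff₀ (by positivity) (by positivity)]
  calc (h k : ℝ) * k ≤ C * (2 * k) ^ s * k := by
        gcongr
        exact h1.trans (by gcongr)
    _ = C * 2 ^ s * k ^ (s + 1) := by ring
    _ ≤ C * 2 ^ s * k ^ p := by gcongr

theorem le_of_tendsto_of_le_growth {h : ℕ → ℕ} (hmono : Monotone h) {p s m₀ E : ℕ} {a : ℝ}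
    (hlim : Filter.Tendsto (fun k : ℕ => (h k : ℝ) / (k : ℝ) ^ p) Filter.atTop (nhds a))
    (hlow : ∀ D, (D + 1) ^ s ≤ h (m₀ + E * D)) : s ≤ p := by
  by_contra! hps
  -- The slope E + 1 instead of E makes the subsequence tend to infinity even if E = 0; along it, s
  -- > p would make the quotient unbounded.
  have hsub : Filter.Tendsto (fun D : ℕ => m₀ + (E + 1) * D) Filter.atTop Filter.atTop :=
    Filter.tendsto_atTop_mono (fun D => by simp only [id]; nlinarith) Filter.tendsto_id
  have hlim' := hlim.comp hsub
  refine not_tendsto_nhds_of_tendsto_atTop ?_ a hlim'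
  have hlin : Filter.Tendsto (fun D : ℕ => (D : ℝ) / ((m₀ : ℝ) + E + 1) ^ p) Filter.atTop
      Filter.atTop :=
    (tendsto_natCast_atTop_atTop).atTop_div_const (by positivity)
  refine Filter.tendsto_atTop_mono' _ ?_ hlin
  filter_upwards [Filter.eventually_ge_atTop 1] with D hD
  have hD' : (1 : ℝ) ≤ D := by exact_mod_cast hD
  have h1 : ((D : ℝ) + 1) ^ s ≤ (h (m₀ + (E + 1) * D) : ℝ) := by
    exact_mod_cast (hlow D).trans (hmono (by nlinarith))
  have h2 : ((D : ℝ) + 1) ^ (p + 1) ≤ ((D : ℝ) + 1) ^ s :=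
    pow_le_pow_right₀ (by linarith) hps
  have h3 : ((m₀ + (E + 1) * D : ℕ) : ℝ) ≤ ((m₀ : ℝ) + E + 1) * (D + 1) := by
    push_cast
    have : (0 : ℝ) ≤ m₀ * D := by positivity
    have : (0 : ℝ) ≤ E := by positivity
    nlinarith
  have h4 : (0 : ℝ) < ((m₀ + (E + 1) * D : ℕ) : ℝ) := by
    have : 0 < m₀ + (E + 1) * D := by nlinarith
    exact_mod_cast this
  rw [Function.comp_apply, div_le_div_iff₀ (by positivity) (by positivity)]
  calc (D : ℝ) * ((m₀ + (E + 1) * D : ℕ) : ℝ) ^ p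
      ≤ (D + 1) * (((m₀ : ℝ) + E + 1) * (D + 1)) ^ p := by gcongr; linarith
    _ = (D + 1) ^ (p + 1) * ((m₀ : ℝ) + E + 1) ^ p := by rw [mul_pow]; ring
    _ ≤ h (m₀ + (E + 1) * D) * ((m₀ : ℝ) + E + 1) ^ p := by
        gcongr
        exact h2.trans h1

/-- The rank of a module that is exhausted by submodules of eventually constant rank. -/
theorem finrank_fractionRing_tensor {n : ℕ} {N : Type*} [AddCommGroup N] [Module (PolyX n) N]
    {U : ℤ → Submodule (PolyX n) N} (hmono : Monotone U) (hex : ∀ v, ∃ k, v ∈ U k)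
    (hfin : ∀ k, Module.Finite (PolyX n) (U k)) {m : ℤ}
    (hm : ∀ᶠ k in Filter.atTop, (Module.finrank (PolyX n) (U k) : ℤ) = m) :
    Module.Finite (RatX n) (TensorProduct (PolyX n) (RatX n) N) ∧
      (Module.finrank (RatX n) (TensorProduct (PolyX n) (RatX n) N) : ℤ) = m := by
  obtain ⟨k₁, hk₁⟩ := Filter.eventually_atTop.1 hm
  -- A finite independent family lies in some U k with k ≥ k₁, so it has at most m members; the rank
  -- of N is that of U k₁.
  have hrank : Module.rank (PolyX n) N = (Module.finrank (PolyX n) (U k₁) : Cardinal) := by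
    apply le_antisymm
    · refine rank_le fun s hs => ?_
      have hsU : ∃ k, k₁ ≤ k ∧ ∀ v ∈ s, v ∈ U k := by
        choose κ hκ using hex
        obtain ⟨k, hk⟩ := (insert k₁ (s.image κ)).exists_le
        refine ⟨k, hk _ (Finset.mem_insert_self _ _), fun v hv => hmono (hk _ ?_) (hκ v)⟩
        exact Finset.mem_insert_of_mem (Finset.mem_image_of_mem _ hv)
      obtain ⟨k, hk, hsk⟩ := hsU
      have hli : LinearIndependent (PolyX n) (fun v : s => (⟨v, hsk v v.2⟩ : U k)) :=
        LinearIndependent.of_comp (U k).subtype hs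
      have := hfin k
      have h1 := hli.fintype_card_le_finrank
      rw [Fintype.card_coe] at h1
      have h2 := hk₁ k hk
      have h3 := hk₁ k₁ le_rfl
      omega
    · have := hfin k₁
      rw [Module.finrank_eq_rank]
      exact Submodule.rank_le _
  have hK : Module.rank (RatX n) (TensorProduct (PolyX n) (RatX n) N) =
      (Module.finrank (PolyX n) (U k₁) : Cardinal) :=
    (IsBaseChange.rank_eq (TensorProduct.isBaseChange (PolyX n) N (RatX n))).trans hrank
  refine ⟨?_, ?_⟩
  · rw [← Module.rank_lt_aleph0_iff, hK]
    exact Cardinal.natCast_lt_aleph0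
  · rw [Module.finrank, hK, Cardinal.toNat_natCast]
    exact hk₁ k₁ le_rfl

/-! ### The complex vector space structure of the associated graded module -/

namespace FFiltration

variable {n : ℕ} {M : Type*} [AddCommGroup M] [Module (Weyl n) M] [Module (PolyX n) M]
  [IsScalarTower (PolyX n) (Weyl n) M] (F : FFiltration n M)

instance grVectorSpace : Module ℂ F.Gr := Module.compHom F.Gr (MvPolynomial.C : ℂ →+* PolyX n)

instance gr_isScalarTower_polyX : IsScalarTower ℂ (PolyX n) F.Gr :=
  ⟨fun c p g => by rw [MvPolynomial.smul_eq_C_mul, mul_smul]; rfl⟩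

instance gr_isScalarTower_grD : IsScalarTower ℂ (GrD n) F.Gr :=
  ⟨fun c f g => by
    rw [← algebraMap_smul (PolyX n) c f, smul_assoc]
    rfl⟩

end FFiltration

/-! ### Growth and dimension of the fibers and of the associated graded module -/

namespace FFiltration.FreeResolution

variable {n : ℕ} {M : Type*} [AddCommGroup M] [Module (Weyl n) M] [Module (PolyX n) M]
  [IsScalarTower (PolyX n) (Weyl n) M] {F : FFiltration n M} (L : F.FreeResolution)

theorem monotone_finrank_piece (L : F.FreeResolution) :
    Monotone fun k => Module.finrank (PolyX n) (F.toFun k) := by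
  intro k l hkl
  have := L.finite_piece l
  change Module.finrank (PolyX n) (F.toFun k) ≤ Module.finrank (PolyX n) (F.toFun l)
  rw [← (Submodule.submoduleOfEquivOfLe (F.mono hkl)).finrank_eq,
    ← ((F.toFun k).submoduleOf (F.toFun l)).finrank_quotient_add_finrank]
  exact Nat.le_add_left _ _

/-- The degree of the Hilbert function of a fiber is the dimension of its support. -/
theorem supportDim_fiber (L : F.FreeResolution) (x₀ : Fin n → ℂ) {p : ℕ} {a : ℝ} (ha : a ≠ 0)
    (hlim : Filter.Tendsto
      (fun k : ℕ => (Module.finrank ℂ (F.fiberUpTo x₀ k) : ℝ) / (k : ℝ) ^ p) Filter.atTop (nhds a)) :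
    Module.supportDim (PolyXi n) (F.Fiber x₀) = p := by
  have := L.finite_fiber x₀
  have hfd := L.finite_fiberUpTo x₀
  -- A zero fiber would have limit 0.
  have : Nontrivial (F.Fiber x₀) := by
    by_contra hcon
    rw [not_nontrivial_iff_subsingleton] at hcon
    refine ha (tendsto_nhds_unique hlim ?_)
    have h0 : ∀ k : ℕ, Module.finrank ℂ (F.fiberUpTo x₀ k) = 0 := fun k =>
      Module.finrank_zero_of_subsingleton
    simp [h0]
  obtain ⟨s, hs, -⟩ := exists_noether_normalization (k := ℂ) (A := PolyXi n) (N := F.Fiber x₀)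
  rw [hs]
  have hmono : Monotone fun k : ℕ => F.fiberUpTo x₀ (k : ℤ) := fun k l hkl =>
    F.fiberUpTo_mono x₀ (by exact_mod_cast hkl)
  have hmono' : Monotone fun k : ℕ => Module.finrank ℂ (F.fiberUpTo x₀ (k : ℤ)) := fun k l hkl =>
    Submodule.finrank_mono (hmono hkl)
  obtain ⟨m₀, E, hlow⟩ := exists_le_finrank_filtration (A := PolyXi n) hmono
    (L.exists_mem_fiberUpTo x₀) (L.exists_smul_mem_fiberUpTo x₀) hs
  have h1 := le_of_tendsto_of_le_growth hmono' hlim hlow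
  let X : Finset (PolyXi n) := Finset.univ.image MvPolynomial.X
  let W : Submodule ℂ (F.Fiber x₀) :=
    Submodule.span ℂ (Set.range fun j => F.toFiber x₀ (L.genSymbol j))
  have hW : FiniteDimensional ℂ W := FiniteDimensional.span_of_finite ℂ (Set.finite_range _)
  obtain ⟨C, hC⟩ := exists_finrank_reach_le (A := PolyXi n) X W hs
  obtain ⟨k₀, h₀⟩ := L.exists_le_shift
  -- A monomial ξ^β g_j of degree at most k has |β| ≤ k - k₀, so it is reached from the generators
  -- in that many steps.
  have hle : ∀ k : ℕ, F.fiberUpTo x₀ k ≤ reach X W (k + (-k₀).toNat) := by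
    intro k
    rw [L.fiberUpTo_eq_span, Submodule.span_le]
    rintro _ ⟨b, hb, rfl⟩
    have hb' : L.shift 0 b.1 + (b.2.degree : ℤ) ≤ k := hb
    have h₀' := h₀ b.1
    change F.toFiber x₀ ((MvPolynomial.monomial b.2 1 : GrD n) • L.genSymbol b.1) ∈ _
    rw [F.toFiber_monomial_smul, MvPolynomial.monomial_eq, map_one, one_mul,
      Finsupp.prod_fintype _ _ (by simp)]
    have := prod_pow_smul_mem_reach (X := X) (W := W) (m := 0) (x := MvPolynomial.X)
      (fun i => Finset.mem_image_of_mem _ (Finset.mem_univ i))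
      (Submodule.subset_span ⟨b.1, rfl⟩ : F.toFiber x₀ (L.genSymbol b.1) ∈ W) Finset.univ b.2
    refine reach_mono X W ?_ this
    rw [Finsupp.degree_eq_sum] at hb'
    omega
  have hup : ∀ k : ℕ, Module.finrank ℂ (F.fiberUpTo x₀ k) ≤
      C * ((-k₀).toNat + 1) ^ s * (k + 1) ^ s := by
    intro k
    have := (hC (k + (-k₀).toNat)).1
    calc Module.finrank ℂ (F.fiberUpTo x₀ k)
        ≤ Module.finrank ℂ (reach X W (k + (-k₀).toNat)) := Submodule.finrank_mono (hle k)
      _ ≤ C * (k + (-k₀).toNat + 1) ^ s := (hC _).2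
      _ ≤ C * (((-k₀).toNat + 1) * (k + 1)) ^ s := by gcongr; nlinarith
      _ = _ := by rw [mul_pow, mul_assoc]
  have h2 := le_of_tendsto_of_growth_le ha hlim hup
  exact_mod_cast le_antisymm h1 h2

/-- If the ranks of the pieces of `M` grow like `k^p`, then `gr^F(M)` has dimension at least
`n + p`. -/
theorem add_le_of_supportDim_gr (L : F.FreeResolution) {p s : ℕ} {a : ℝ} (ha : a ≠ 0)
    (hlim : Filter.Tendsto
      (fun k : ℕ => (Module.finrank (PolyX n) (F.toFun k) : ℝ) / (k : ℝ) ^ p)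
      Filter.atTop (nhds a))
    (hs : Module.supportDim (GrD n) F.Gr = s) : n + p ≤ s := by
  classical
  have := L.finite_gr
  have : Nontrivial F.Gr := by
    rw [← Module.supportDim_ne_bot_iff_nontrivial (R := GrD n), hs]
    exact WithBot.coe_ne_bot
  let X : Finset (GrD n) := Finset.univ.image
    (Sum.elim (fun i : Fin n => MvPolynomial.C (MvPolynomial.X i)) MvPolynomial.X)
  let W : Submodule ℂ F.Gr := Submodule.span ℂ (Set.range L.genSymbol)
  have hW : FiniteDimensional ℂ W := FiniteDimensional.span_of_finite ℂ (Set.finite_range _)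
  obtain ⟨C, hC⟩ := exists_finrank_reach_le (A := GrD n) X W hs
  obtain ⟨k₀, h₀⟩ := L.exists_le_shift
  obtain ⟨Std, q, hq, hli, hspan⟩ := L.exists_standard_mon
  -- Each standard monomial of degree at most k is multiplied by the (k+1)^n monomials in x with
  -- exponents at most k; these have degree at most nk, whence the extra steps.
  have hlow : ∀ k : ℕ, (k + 1) ^ n * Module.finrank (PolyX n) (F.toFun k) ≤
      Module.finrank ℂ (reach X W (k + (-k₀).toNat + n * k)) := by
    intro k
    have hfin : Finite {b // b ∈ Std ∧ L.deg b ≤ k} :=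
      ((L.finite_deg_le k).subset fun b hb => hb.2).to_subtype
    have := Fintype.ofFinite {b // b ∈ Std ∧ L.deg b ≤ k}
    have hli' : LinearIndependent (PolyX n)
        (fun b : {b // b ∈ Std ∧ L.deg b ≤ k} => L.mon b.1) :=
      hli.comp (fun b : {b // b ∈ Std ∧ L.deg b ≤ k} => (⟨b.1, b.2.1⟩ : Std)) fun b b' h =>
        Subtype.ext (congrArg (fun x : Std => x.1) h)
    have hmon : LinearIndependent ℂ (fun α : Fin n → Fin (k + 1) =>
        (MvPolynomial.monomial (Finsupp.equivFunOnFinite.symm fun i => (α i : ℕ)) 1 : PolyX n)) := by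
      have h := (MvPolynomial.basisMonomials (Fin n) ℂ).linearIndependent
      rw [MvPolynomial.coe_basisMonomials] at h
      refine h.comp (fun α : Fin n → Fin (k + 1) =>
        Finsupp.equivFunOnFinite.symm fun i => (α i : ℕ)) fun α α' h => ?_
      have := Finsupp.equivFunOnFinite.symm.injective h
      funext i
      exact Fin.ext (congrFun this i)
    -- Independence over ℂ of the x-monomials and over ℂ[x] of the standard monomials gives
    -- independence over ℂ of the products.
    have hprod := linearIndependent_smul hmon hli'
    have hmem : ∀ b : (Fin n → Fin (k + 1)) × {b // b ∈ Std ∧ L.deg b ≤ k},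
        (MvPolynomial.monomial (Finsupp.equivFunOnFinite.symm fun i => (b.1 i : ℕ)) 1 : PolyX n) •
          L.mon b.2.1 ∈ reach X W (k + (-k₀).toNat + n * k) := by
      rintro ⟨α, b, hbS, hb⟩
      have hb' : L.shift 0 b.1 + (b.2.degree : ℤ) ≤ k := hb
      have h₀' := h₀ b.1
      change _ • (MvPolynomial.monomial b.2 1 : GrD n) • L.genSymbol b.1 ∈ _
      rw [← C_smul, MvPolynomial.monomial_eq, MvPolynomial.monomial_eq, map_one, map_one, one_mul,
        one_mul, Finsupp.prod_fintype _ _ (by simp), Finsupp.prod_fintype _ _ (by simp), map_prod]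
      simp_rw [map_pow]
      have h1 := prod_pow_smul_mem_reach (X := X) (W := W) (m := 0)
        (x := fun i => (MvPolynomial.X i : GrD n))
        (fun i => Finset.mem_image.2 ⟨Sum.inr i, Finset.mem_univ _, rfl⟩)
        (Submodule.subset_span ⟨b.1, rfl⟩ : L.genSymbol b.1 ∈ W) Finset.univ b.2
      have h2 := prod_pow_smul_mem_reach (X := X) (W := W)
        (x := fun i => (MvPolynomial.C (MvPolynomial.X i) : GrD n))
        (fun i => Finset.mem_image.2 ⟨Sum.inl i, Finset.mem_univ _, rfl⟩)
        (reach_mono X W (show _ ≤ k + (-k₀).toNat by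
          rw [Finsupp.degree_eq_sum] at hb'
          omega) h1) Finset.univ (fun i => (α i : ℕ))
      refine reach_mono X W ?_ h2
      have : ∑ i, (α i : ℕ) ≤ n * k := by
        refine (Finset.sum_le_card_nsmul _ _ k fun i _ => Nat.lt_succ_iff.1 (α i).2).trans ?_
        simp
      omega
    have hprod' : LinearIndependent ℂ
        (fun b : (Fin n → Fin (k + 1)) × {b // b ∈ Std ∧ L.deg b ≤ k} =>
          (⟨_, hmem b⟩ : reach X W (k + (-k₀).toNat + n * k))) :=
      LinearIndependent.of_comp (Submodule.subtype _) hprod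
    have := (hC (k + (-k₀).toNat + n * k)).1
    have hcard := hprod'.fintype_card_le_finrank
    rw [Fintype.card_prod, ← Nat.card_eq_fintype_card (α := {b // b ∈ Std ∧ L.deg b ≤ k}),
      L.card_standard hq hli hspan] at hcard
    simpa using hcard
  -- The left side of `hlow` grows like a k^{n+p}; the constant comes from k + c + nk + 1 ≤
  -- (c+n+1)(k+1) with c = (-k₀).toNat.
  refine le_of_tendsto_of_growth_le (C := C * ((-k₀).toNat + n + 1) ^ s) ha
    (h := fun k => (k + 1) ^ n * Module.finrank (PolyX n) (F.toFun k)) ?_ fun k => ?_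
  · have h1 : Filter.Tendsto (fun k : ℕ => (1 + 1 / (k : ℝ)) ^ n) Filter.atTop (nhds 1) := by
      have := ((tendsto_const_nhds (x := (1 : ℝ))).add
        (tendsto_const_div_atTop_nhds_zero_nat (1 : ℝ))).pow n
      simpa using this
    have h2 := h1.mul hlim
    rw [one_mul] at h2
    refine h2.congr' ?_
    filter_upwards [Filter.eventually_gt_atTop 0] with k hk
    have : (k : ℝ) ≠ 0 := by positivity
    rw [pow_add]
    push_cast
    rw [show (1 + 1 / (k : ℝ)) = (k + 1) / k by field_simp, div_pow]
    field_simp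
  · calc (k + 1) ^ n * Module.finrank (PolyX n) (F.toFun k)
        ≤ C * (k + (-k₀).toNat + n * k + 1) ^ s := (hlow k).trans (hC _).2
      _ ≤ C * (((-k₀).toNat + n + 1) * (k + 1)) ^ s := by
          gcongr
          nlinarith [Nat.zero_le ((-k₀).toNat * k)]
      _ = _ := by rw [mul_pow, mul_assoc]

end FFiltration.FreeResolution

end WeylMultidegree

end

/-! ### Multidegree, generic fibers and holonomic rank -/

open WeylMultidegree in
theorem proposition6 (n : ℕ) (M : Type*) [AddCommGroup M] [Module (Weyl n) M]
    [Module (PolyX n) M] [IsScalarTower (PolyX n) (Weyl n) M]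
    (F : FFiltration n M) (hF : F.IsGood) (L : F.FreeResolution)
    (m : ℤ) (d : ℕ) (hC : L.multidegree = Polynomial.monomial d m) :
    -- for generic `x₀`:
    (∃ q : PolyX n, q ≠ 0 ∧ ∀ x₀ : Fin n → ℂ, MvPolynomial.eval x₀ q ≠ 0 →
      IsMultiplicity (n := n) (F.fiberPiece x₀) m ∧
      (m ≠ 0 → HasCodim n (F.Fiber x₀) d ∧ SetHasCodim (F.charFiber x₀) d) ∧
      (m = 0 → Subsingleton (F.Fiber x₀) ∧ F.charFiber x₀ = ∅)) ∧
    -- the holonomic case: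
    (F.IsHolonomic →
      (Module.Finite (RatX n) (TensorProduct (PolyX n) (RatX n) M) ∧
        (Module.finrank (RatX n) (TensorProduct (PolyX n) (RatX n) M) : ℤ) = m) ∧
      (Module.Finite (RatX n) (TensorProduct (PolyX n) (RatX n) F.Gr) ∧
        (Module.finrank (RatX n) (TensorProduct (PolyX n) (RatX n) F.Gr) : ℤ) = m)) := by
  have hgr := L.finite_gr
  obtain ⟨hzero, hne⟩ := growth_of_leastTerm hC L.monotone_finrank_piece L.finrank_piece
  have hlim : m ≠ 0 → Filter.Tendsto
      (fun k : ℕ => (Module.finrank (PolyX n) (F.toFun k) : ℝ) / (k : ℝ) ^ (n - d)) Filter.atTop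
      (nhds ((m : ℝ) / (n - d).factorial)) := by
    intro hm
    refine ((hne hm).2.1.div_const _).congr fun k => ?_
    field_simp
  have ha : m ≠ 0 → (m : ℝ) / (n - d).factorial ≠ 0 := fun hm => by positivity
  constructor
  · obtain ⟨q, hq, hfib⟩ := L.exists_finrank_fiberUpTo
    refine ⟨q, hq, fun x₀ hx₀ => ?_⟩
    have hfin := L.finite_fiber x₀
    have hfd := L.finite_fiberUpTo x₀
    rcases eq_or_ne m 0 with rfl | hm
    · have hsub : Subsingleton (F.Fiber x₀) := by
        refine subsingleton_of_forall_eq 0 fun v => ?_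
        obtain ⟨k, hk⟩ := L.exists_mem_fiberUpTo x₀ v
        have h0 : Module.finrank ℂ (F.fiberUpTo x₀ k) = 0 := by
          rw [hfib x₀ hx₀]
          exact hzero rfl k
        rw [Submodule.finrank_eq_zero.1 h0] at hk
        exact hk
      exact ⟨Or.inl ⟨hsub, rfl⟩, fun h => absurd rfl h, fun _ => ⟨hsub, F.charFiber_eq_empty x₀⟩⟩
    · have hdim : Module.supportDim (PolyXi n) (F.Fiber x₀) = (n - d : ℕ) := by
        refine L.supportDim_fiber x₀ (ha hm) ?_
        simp_rw [hfib x₀ hx₀]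
        exact hlim hm
      have hcodim : HasCodim n (F.Fiber x₀) d := by
        unfold HasCodim
        rw [hdim]
        exact_mod_cast congrArg (Nat.cast : ℕ → WithBot ℕ∞) (Nat.sub_add_cancel (hne hm).1)
      refine ⟨Or.inr ⟨n - d, hdim, hfd, ?_⟩, fun _ => ⟨hcodim, F.setHasCodim_charFiber x₀ hcodim⟩,
        fun h => absurd h hm⟩
      have h := (hne hm).2.1
      simp_rw [← hfib x₀ hx₀] at h
      exact h
  · intro hhol
    have hev : ∀ᶠ k in Filter.atTop, (Module.finrank (PolyX n) (F.toFun k) : ℤ) = m := by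
      rcases eq_or_ne m 0 with rfl | hm
      · exact Filter.Eventually.of_forall fun k => by exact_mod_cast hzero rfl k
      -- It remains to see d = n. The case M = 0 contradicts the nonzero limit, and dim gr(M) = n
      -- leaves n + (n-d) ≤ n.
      · refine (hne hm).2.2 (le_antisymm (hne hm).1 ?_)
        rcases hhol with hM | hdim
        · refine absurd (tendsto_nhds_unique (hlim hm) ?_) (ha hm)
          have h0 : ∀ k : ℕ, Module.finrank (PolyX n) (F.toFun k) = 0 := fun k =>
            Module.finrank_zero_of_subsingleton
          simp [h0]
        · have := L.add_le_of_supportDim_gr (ha hm) (hlim hm) hdim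
          omega
    refine ⟨finrank_fractionRing_tensor F.mono F.exhaustive L.finite_piece hev,
      finrank_fractionRing_tensor F.upTo_mono F.exists_mem_upTo L.finite_upTo ?_⟩
    simp_rw [L.finrank_upTo]
    exact hev
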